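/- Let $d\ge 3$ be an integer and let $p,q$ be real numbers with $1\le p<d$ and $q>\frac{dp}{d-p}$. Consider $\mathbb Z^d$ as a graph with $x\sim y$ iff $x-y=\pm e_i$ for some standard unit vector $e_i$, and for $u:\mathbb Z^d\to\mathbb R$ put $$\|u\|_q=\Big(\sum_{x}|u(x)|^q\Big)^{1/q},\qquad \|\nabla u\|_p=\Big(\tfrac12\sum_{x}\sum_{y\sim x}|u(x)-u(y)|^p\Big)^{1/p}.$$ Let $D^{1,p}(\mathbb Z^d)$ be the completion of the finitely supported functions in the norm $\|\nabla u\|_p$, regarded as a space of functions: $u\in D^{1,p}(\mathbb Z^d)$ iff there are finitely supported $\varphi_n$ with $\|\nabla(u-\varphi_n)\|_p\to0$ and $\varphi_n\to u$ pointwise. *Schwarz symmetric functions.* A function $u:\mathbb Z^d\to[0,\infty)$ is admissible if $\{u>t\}$ is finite for every $t>0$. Let $\vec E=\{e_i,\frac{e_i+e_j}2,\frac{e_i-e_j}2: 1\le i<j\le d\}$ (with $1\le i\le d$ for $e_i$). For $e\in\vec E$, each class of the relation "$x-y$ is parallel to $e$" on $\mathbb Z^d$ is mapped bijectively by $x\mapsto\langle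 e,x\rangle$ onto $\mathbb Z$ or $\mathbb Z+\frac12$. For admissible $u$, the one-step rearrangement $R_eu$ is obtained by rearranging $u$ on each class: if $a_1\ge a_2\ge\cdots$ are the values of $u$ on the class in decreasing order with multiplicity, i.e. $a_n=\sup\{\min_\Omega u:\Omega\text{ a subset of the class},\ |\Omega|=n\}$, then $R_eu(x)=a_{2s}$ if $s=\langle e,x\rangle>0$ and $R_eu(x)=a_{1-2s}$ if $s\le0$. Given an enumeration of $\vec E$, let $R^ku$ be the result of applying to $u$ the first $k$ one-step rearrangements, with the directions running cyclically through the enumeration. The Schwarz rearrangement of $u$ is the pointwise limit $\lim_{k\to\infty}R^ku$, and an admissible $u$ is called Schwarz symmetric if it is equal to its Schwarz rearrangement, for every enumeration of $\vec E$. **Theorem.** The minimization problem $$I=\inf\{\|\nabla u\|_p:\ u\in D^{1,p}(\mathbb Z^d),\ \|u\|_q=1\}$$ has a Schwarz symmetric solution: there is a Schwarz symmetric $u\in D^{1,p}(\mathbb Z^d)$ with $\|u\|_q=1$ and $\|\nabla u\|_p=I$. -/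

import Mathlib

open Filter Topology
open scoped ENNReal

namespace DiscreteSchwarz

/-- The vertex set `ℤ^d`. -/
abbrev Lattice (d : ℕ) : Type := Fin d → ℤ

/-- The `d`-dimensional lattice graph: `x ∼ y` iff `x - y = ± e_i` for some `i`. -/
def latticeGraph (d : ℕ) : SimpleGraph (Lattice d) where
  Adj x y := ∃ i : Fin d, x = y + Pi.single i 1 ∨ x = y - Pi.single i 1
  symm := ⟨by
    rintro x y ⟨i, h | h⟩
    · exact ⟨i, Or.inr (by rw [h]; abel)⟩
    · exact ⟨i, Or.inl (by rw [h]; abel)⟩⟩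
  loopless := ⟨by
    rintro x ⟨i, h | h⟩
    · have := congrFun h i
      simp at this
    · have := congrFun h i
      simp at this
      omega⟩

/-- The `ℓ^q` norm `(∑ |u(x)|^q)^{1/q}`, as an extended nonnegative real. -/
noncomputable def lNorm {d : ℕ} (q : ℝ) (u : Lattice d → ℝ) : ℝ≥0∞ :=
  (∑' x, ‖u x‖ₑ ^ q) ^ (1 / q)

/-- `‖∇u‖_p = (½ ∑_x ∑_{y ∼ x} |u(x) - u(y)|^p)^{1/p}`, as an extended nonnegative real. -/
noncomputable def gradNorm {d : ℕ} (p : ℝ) (u : Lattice d → ℝ) : ℝ≥0∞ :=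
  ((∑' x, ∑' y : (latticeGraph d).neighborSet x, ‖u x - u y‖ₑ ^ p) / 2) ^ (1 / p)

/-- `D^{1,p}(ℤ^d)`, the completion of the finitely supported functions in the norm `‖∇u‖_p`,
realized as a space of functions: `u` is the pointwise limit of finitely supported functions `φ n`
which also converge to `u` in the gradient norm. (For `1 ≤ p < d` every `‖∇·‖_p`-Cauchy sequence of
finitely supported functions converges pointwise and in the gradient norm to a unique function, and
two such sequences have the same limit iff they represent the same element of the completion.
Pointwise convergence is required because the gradient norm does not see constants.) -/
def MemD {d : ℕ} (p : ℝ) (u : Lattice d → ℝ) : Prop :=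
  ∃ φ : ℕ → Lattice d → ℝ,
    (∀ n, (Function.support (φ n)).Finite) ∧
    Tendsto (fun n => gradNorm p (u - φ n)) atTop (𝓝 0) ∧
    ∀ x, Tendsto (fun n => φ n x) atTop (𝓝 (u x))

/-- The constraint set `{u ∈ D^{1,p}(ℤ^d) : ‖u‖_q = 1}`. -/
def sobolevConstraint (d : ℕ) (p q : ℝ) : Set (Lattice d → ℝ) :=
  {u | MemD p u ∧ lNorm q u = 1}

/-- The infimum `inf {‖∇u‖_p : u ∈ D^{1,p}(ℤ^d), ‖u‖_q = 1}`. -/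
noncomputable def sobolevInf (d : ℕ) (p q : ℝ) : ℝ≥0∞ :=
  ⨅ u ∈ sobolevConstraint d p q, gradNorm p u

/-- Admissible functions `C_0^+(ℤ^d)`: nonnegative and vanishing at infinity. -/
def Admissible {d : ℕ} (u : Lattice d → ℝ) : Prop :=
  (∀ x, 0 ≤ u x) ∧ ∀ t : ℝ, 0 < t → {x | t < |u x|}.Finite

/-- The `n`-th largest value (`n ≥ 1`, with multiplicity) of `u` on the set `L`:
the supremum over `Ω ⊆ L` with `|Ω| = n` of `min_Ω u`. -/
noncomputable def nthLargest {d : ℕ} (u : Lattice d → ℝ) (L : Set (Lattice d)) (n : ℕ) : ℝ :=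
  sSup {t | ∃ (Ω : Finset (Lattice d)) (hΩ : Ω.Nonempty),
    (Ω : Set (Lattice d)) ⊆ L ∧ Ω.card = n ∧ t = Ω.inf' hΩ u}

/-- The set of directions `{e_i, (e_i + e_j)/2, (e_i - e_j)/2 : i < j}`. -/
inductive Direction (d : ℕ) : Type
  | axis (i : Fin d) : Direction d
  | plus (i j : Fin d) (h : i < j) : Direction d
  | minus (i j : Fin d) (h : i < j) : Direction d

/-- The integer vector `2e` of a direction `e`. -/
def Direction.twice {d : ℕ} : Direction d → Lattice d
  | .axis i => Pi.single i 2
  | .plus i j _ => Pi.single i 1 + Pi.single j 1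
  | .minus i j _ => Pi.single i 1 - Pi.single j 1

/-- The class of `x` in `ℤ^d`: all `y` such that `y - x` is parallel to `e` in `ℝ^d`. -/
def Direction.line {d : ℕ} (e : Direction d) (x : Lattice d) : Set (Lattice d) :=
  {y | ∃ c : ℝ, ∀ k, ((y k - x k : ℤ) : ℝ) = c * (e.twice k : ℝ)}

/-- The index of the value which the one-dimensional rearrangement on `ℤ` or `ℤ + 1/2` puts at the
position `s`, where `t = 2s`: it is `2s` for `s > 0` and `1 - 2s` for `s ≤ 0`. -/
def rank (t : ℤ) : ℕ := if 0 < t then t.toNat else (1 - t).toNat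

/-- The one-step rearrangement `R_e`: on each line parallel to `e`, identified with `ℤ` or
`ℤ + 1/2` by `x ↦ ⟨e, x⟩`, it is the one-dimensional rearrangement. -/
noncomputable def oneStep {d : ℕ} (e : Direction d) (u : Lattice d → ℝ) : Lattice d → ℝ :=
  fun x => nthLargest u (e.line x) (rank (∑ k, e.twice k * x k))

/-- `R^k`: apply the one-step rearrangements along `σ 0, σ 1, …, σ (k-1)` in turn. -/
noncomputable def iterStep {d : ℕ} (σ : ℕ → Direction d) : ℕ → (Lattice d → ℝ) → Lattice d → ℝ
  | 0, u => u
  | k + 1, u => oneStep (σ k) (iterStep σ k u)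

/-- `σ` runs cyclically, with period `n`, through all directions, listed without repetition. -/
def IsCyclicEnumeration {d : ℕ} (n : ℕ) (σ : ℕ → Direction d) : Prop :=
  Set.BijOn σ (Set.Iio n) Set.univ ∧ ∀ k, σ (k + n) = σ k

/-- `v` is the Schwarz rearrangement of `u` for the order `σ` of the directions:
`v(x) = lim_k R^k u(x)` for every `x`. -/
def IsSchwarzRearrangement {d : ℕ} (σ : ℕ → Direction d) (u v : Lattice d → ℝ) : Prop :=
  ∀ x, Tendsto (fun k => iterStep σ k u x) atTop (𝓝 (v x))

/-- `u` is Schwarz symmetric: it is admissible and equal to its own Schwarz rearrangement, for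
every cyclic order of the one-step rearrangements. -/
def SchwarzSymmetric {d : ℕ} (u : Lattice d → ℝ) : Prop :=
  Admissible u ∧ ∀ (n : ℕ) (σ : ℕ → Direction d), IsCyclicEnumeration n σ →
    IsSchwarzRearrangement σ u u

/-- Cyclic enumerations of the directions exist. -/
theorem exists_isCyclicEnumeration {d : ℕ} (hd : 0 < d) :
    ∃ (n : ℕ) (σ : ℕ → Direction d), IsCyclicEnumeration n σ := by
  classical
  let f : Direction d → Fin 3 × Fin d × Fin d := fun e => match e with
    | .axis i => (0, i, i)
    | .plus i j _ => (1, i, j)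
    | .minus i j _ => (2, i, j)
  have hf : Function.Injective f := by
    intro a b hab
    cases a <;> cases b <;> simp_all [f]
  have : Finite (Direction d) := Finite.of_injective f hf
  obtain ⟨n, ⟨g⟩⟩ := Finite.exists_equiv_fin (Direction d)
  have hn : 0 < n := (g (.axis ⟨0, hd⟩)).pos
  refine ⟨n, fun k => g.symm ⟨k % n, Nat.mod_lt _ hn⟩, ⟨fun _ _ => Set.mem_univ _, ?_, ?_⟩, ?_⟩
  · intro a ha b hb hab
    have h := congrArg Fin.val (g.symm.injective hab)
    simpa [Nat.mod_eq_of_lt (Set.mem_Iio.1 ha), Nat.mod_eq_of_lt (Set.mem_Iio.1 hb)] using h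
  · intro e _
    exact ⟨g e, (g e).2, by simp [Nat.mod_eq_of_lt (g e).2]⟩
  · intro k
    simp

end DiscreteSchwarz

/-!
The minimizer is found by the direct method, applied to functions which are fixed by all
polarizations (two-point rearrangements) attached to the directions `e`.

*Polarization instead of one-step rearrangement.* On a line parallel to `e`, the rearrangement `R_e`
fills the places of level `t = ⟨2e, x⟩` in the order of `rank t`. The place of rank `n + 1` is the
mirror image of the place of rank `n` under `t ↦ -t` if `t > 0`, and under `t ↦ 2 - t` if `t ≤ 0`.
Hence a function is fixed by `R_e` as soon as it is fixed by the two polarizations across these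
mirrors (`oneStep_eq_self`), and an admissible function which is fixed by the polarizations of all
directions, called `Folded` here, is Schwarz symmetric. The reflections are
automorphisms of the lattice, and only edges perpendicular to a mirror cross it, so a polarization
does not increase `‖∇u‖_p`: this is a convexity inequality for four numbers
(`Folding.edgeEnergy_polarize_le`). All favourable half-spaces contain a common point `c`.
Polarizing a function on the wrong side of some mirror therefore moves larger values closer to `c`
and strictly decreases a weighted sum with values in `ℕ`. By well-foundedness every nonnegative
finitely supported function has a folded rearrangement of no larger energy (`exists_folded`).

*Compactness.* The Sobolev inequality (`sobolev_inequality`, proved by the method of Gagliardo and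
Nirenberg) bounds a folded minimizing sequence in `ℓ^r` with `r = dp / (d - p) < q`. A folded
function is at least `u x` at `2 |x_i|` points of the line through `x` parallel to the `i`-th axis,
so the sequence decays at infinity uniformly, and no `ℓ^q` mass is lost in a pointwise limit
(`exists_subseq_tendsto`). By Fatou's lemma the limit has minimal energy. It belongs to `D^{1,p}`
because its truncations `(u - ε)₊` are finitely supported and converge to it
(`memD_of_admissible`). Finally, the infimum over finitely supported functions equals the infimum
over `D^{1,p}` (`finiteInf_le_gradNorm`).
-/

namespace DiscreteSchwarz

/-! ### Polarization on graphs -/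

/-- The sum `∑ |u(x)|^q`, that is, `‖u‖_q^q`. -/
noncomputable def powerSum {V : Type*} (q : ℝ) (u : V → ℝ) : ℝ≥0∞ := ∑' x, ‖u x‖ₑ ^ q

/-- The sum of `|u(x) - u(y)|^p` over all oriented edges, that is, `2 ‖∇u‖_p^p`. -/
noncomputable def edgeEnergy {V : Type*} (G : SimpleGraph V) (p : ℝ) (u : V → ℝ) : ℝ≥0∞ :=
  ∑' a : G.Dart, ‖u a.fst - u a.snd‖ₑ ^ p

/-- A reflection of a graph together with an open half `side`, in which the weight `W` is smaller
than at the mirror image, such that an edge which leaves `side` either joins a vertex to its mirror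
image or ends on the mirror. -/
structure Folding {V : Type*} (G : SimpleGraph V) (W : V → ℕ) where
  /-- The reflection. -/
  refl : V → V
  /-- The open half-space onto which the larger values are moved. -/
  side : Set V
  refl_refl : ∀ x, refl (refl x) = x
  adj_refl : ∀ x y, G.Adj x y → G.Adj (refl x) (refl y)
  refl_notMem : ∀ x ∈ side, refl x ∉ side
  refl_mem_or_eq : ∀ x ∉ side, refl x ∈ side ∨ refl x = x
  crossing : ∀ x y, G.Adj x y → x ∈ side → y ∉ side → y = refl x ∨ refl y = y
  weight_lt : ∀ x ∈ side, W x < W (refl x)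

open Classical in
/-- The polarization (two-point rearrangement) of `u`: of the two values at `x` and at its mirror
image, the larger one is put into the half `side`. -/
noncomputable def Folding.polarize {V : Type*} {G : SimpleGraph V} {W : V → ℕ} (R : Folding G W)
    (u : V → ℝ) (x : V) : ℝ :=
  if x ∈ R.side then max (u x) (u (R.refl x)) else min (u x) (u (R.refl x))

theorem convexOn_abs_rpow {p : ℝ} (hp : 1 ≤ p) :
    ConvexOn ℝ Set.univ fun x : ℝ => |x| ^ p := by
  have h := (convexOn_rpow hp)
  refine ⟨convex_univ, fun x _ y _ a b ha hb hab => ?_⟩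
  have h1 : |a • x + b • y| ≤ a • |x| + b • |y| := by
    simp only [smul_eq_mul]
    calc |a * x + b * y| ≤ |a * x| + |b * y| := abs_add_le _ _
      _ = a * |x| + b * |y| := by rw [abs_mul, abs_mul, abs_of_nonneg ha, abs_of_nonneg hb]
  exact (Real.rpow_le_rpow (abs_nonneg _) h1 (by linarith)).trans
    (h.2 (abs_nonneg x) (abs_nonneg y) ha hb hab)

/-- A convex function of the difference favours pairing larger values with larger values. -/
theorem abs_sub_rpow_swap_le {p : ℝ} (hp : 1 ≤ p) {a a' b b' : ℝ} (ha : a' ≤ a) (hb : b ≤ b') :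
    |a - b'| ^ p + |a' - b| ^ p ≤ |a - b| ^ p + |a' - b'| ^ p := by
  rcases eq_or_lt_of_le (show a' - b' ≤ a - b by linarith) with h | h
  · obtain rfl : a' = a := by linarith
    obtain rfl : b = b' := by linarith
    rfl
  have hc := convexOn_abs_rpow hp
  have hpos : 0 < (a - b) - (a' - b') := by linarith
  set s := (a - a') / ((a - b) - (a' - b')) with hs
  set t := (b' - b) / ((a - b) - (a' - b')) with ht
  have hs0 : 0 ≤ s := div_nonneg (by linarith) hpos.le
  have ht0 : 0 ≤ t := div_nonneg (by linarith) hpos.le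
  have hst : s + t = 1 := by rw [hs, ht]; field_simp; ring
  have hst' : t + s = 1 := by linarith
  have e1 : s * (a - b) + t * (a' - b') = a - b' := by rw [hs, ht]; field_simp; ring
  have e2 : t * (a - b) + s * (a' - b') = a' - b := by rw [hs, ht]; field_simp; ring
  have h1 := hc.2 (Set.mem_univ (a - b)) (Set.mem_univ (a' - b')) hs0 ht0 hst
  have h2 := hc.2 (Set.mem_univ (a - b)) (Set.mem_univ (a' - b')) ht0 hs0 hst'
  simp only [smul_eq_mul, e1, e2] at h1 h2
  calc |a - b'| ^ p + |a' - b| ^ p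
      ≤ (s + t) * |a - b| ^ p + (s + t) * |a' - b'| ^ p := by linarith
    _ = _ := by rw [hst]; ring

theorem enorm_rpow_eq_ofReal {p : ℝ} (hp : 0 ≤ p) (x : ℝ) :
    ‖x‖ₑ ^ p = ENNReal.ofReal (|x| ^ p) := by
  rw [Real.enorm_eq_ofReal_abs, ENNReal.ofReal_rpow_of_nonneg (abs_nonneg x) hp]

theorem enorm_sub_rpow_max_min_le {p : ℝ} (hp : 1 ≤ p) (a a' b b' : ℝ) :
    ‖max a a' - max b b'‖ₑ ^ p + ‖min a a' - min b b'‖ₑ ^ p ≤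
      ‖a - b‖ₑ ^ p + ‖a' - b'‖ₑ ^ p := by
  have hp0 : 0 ≤ p := by linarith
  simp only [enorm_rpow_eq_ofReal hp0]
  have hpos : ∀ x : ℝ, 0 ≤ |x| ^ p := fun x => Real.rpow_nonneg (abs_nonneg x) p
  rw [← ENNReal.ofReal_add (hpos _) (hpos _), ← ENNReal.ofReal_add (hpos _) (hpos _)]
  apply ENNReal.ofReal_le_ofReal
  rcases le_total a a' with ha | ha <;> rcases le_total b b' with hb | hb
  · rw [max_eq_right ha, max_eq_right hb, min_eq_left ha, min_eq_left hb, add_comm]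
  · rw [max_eq_right ha, max_eq_left hb, min_eq_left ha, min_eq_right hb]
    linarith [abs_sub_rpow_swap_le hp ha hb]
  · rw [max_eq_left ha, max_eq_right hb, min_eq_right ha, min_eq_left hb]
    exact abs_sub_rpow_swap_le hp ha hb
  · rw [max_eq_left ha, max_eq_left hb, min_eq_right ha, min_eq_right hb]

/-- Two series may be compared by comparing the sums of the terms over the orbits of an
involution. -/
theorem tsum_le_tsum_of_involutive {α : Type*} {ρ : α → α} (hρ : Function.Involutive ρ)
    {f g : α → ℝ≥0∞} (h : ∀ x, f x + f (ρ x) ≤ g x + g (ρ x)) : ∑' x, f x ≤ ∑' x, g x := by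
  have key : ∀ k : α → ℝ≥0∞, ∑' x, (k x + k (ρ x)) = 2 * ∑' x, k x := fun k => by
    rw [ENNReal.tsum_add, two_mul, hρ.toPerm.tsum_eq k |>.symm]
    rfl
  have := ENNReal.tsum_le_tsum h
  rw [key, key] at this
  exact (ENNReal.mul_le_mul_iff_right two_ne_zero ENNReal.ofNat_ne_top).1 this

namespace Folding

variable {V : Type*} {G : SimpleGraph V} {W : V → ℕ} (R : Folding G W)

theorem polarize_of_mem {u : V → ℝ} {x : V} (h : x ∈ R.side) :
    R.polarize u x = max (u x) (u (R.refl x)) := if_pos h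

theorem polarize_of_notMem {u : V → ℝ} {x : V} (h : x ∉ R.side) :
    R.polarize u x = min (u x) (u (R.refl x)) := if_neg h

theorem polarize_of_refl_eq {u : V → ℝ} {x : V} (h : R.refl x = x) : R.polarize u x = u x := by
  unfold polarize
  split_ifs <;> simp [h]

theorem polarize_refl_of_mem {u : V → ℝ} {x : V} (h : x ∈ R.side) :
    R.polarize u (R.refl x) = min (u x) (u (R.refl x)) := by
  rw [R.polarize_of_notMem (R.refl_notMem x h), R.refl_refl, min_comm]

theorem polarize_eq_or (u : V → ℝ) (x : V) :
    R.polarize u x = u x ∨ R.polarize u x = u (R.refl x) := by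
  unfold polarize
  split_ifs
  · exact max_choice _ _
  · exact min_choice _ _

/-- Polarization permutes the two values at `x` and at its mirror image. -/
theorem polarize_pair (u : V → ℝ) (x : V) :
    (R.polarize u x = u x ∧ R.polarize u (R.refl x) = u (R.refl x)) ∨
      (R.polarize u x = u (R.refl x) ∧ R.polarize u (R.refl x) = u x) := by
  by_cases hx : x ∈ R.side
  · rw [R.polarize_of_mem hx, R.polarize_refl_of_mem hx]
    rcases le_total (u x) (u (R.refl x)) with h | h <;> simp [h]
  · rcases R.refl_mem_or_eq x hx with h | h
    · have e := R.polarize_refl_of_mem (u := u) h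
      rw [R.refl_refl] at e
      rw [R.polarize_of_mem h, e, R.refl_refl]
      rcases le_total (u x) (u (R.refl x)) with h | h <;> simp [h]
    · left
      rw [h]
      exact ⟨R.polarize_of_refl_eq h, R.polarize_of_refl_eq h⟩

theorem powerSum_polarize (q : ℝ) (u : V → ℝ) : powerSum q (R.polarize u) = powerSum q u := by
  have h : ∀ x, ‖R.polarize u x‖ₑ ^ q + ‖R.polarize u (R.refl x)‖ₑ ^ q =
      ‖u x‖ₑ ^ q + ‖u (R.refl x)‖ₑ ^ q := fun x => by
    rcases R.polarize_pair u x with ⟨h1, h2⟩ | ⟨h1, h2⟩ <;> rw [h1, h2]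
    exact add_comm _ _
  exact le_antisymm (tsum_le_tsum_of_involutive R.refl_refl fun x => (h x).le)
    (tsum_le_tsum_of_involutive R.refl_refl fun x => (h x).ge)

/-- The heart of the Pólya–Szegő inequality for polarizations: the joint contribution of an edge
and of its mirror image to the energy does not increase. -/
theorem polarize_edge_le {p : ℝ} (hp : 1 ≤ p) (u : V → ℝ) {x y : V} (hxy : G.Adj x y) :
    ‖R.polarize u x - R.polarize u y‖ₑ ^ p +
        ‖R.polarize u (R.refl x) - R.polarize u (R.refl y)‖ₑ ^ p ≤
      ‖u x - u y‖ₑ ^ p + ‖u (R.refl x) - u (R.refl y)‖ₑ ^ p := by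
  -- An endpoint on the mirror carries twice the same value, so it may be counted on either side.
  have main : ∀ x y, (x ∈ R.side ∨ R.refl x = x) → (y ∈ R.side ∨ R.refl y = y) →
      ‖R.polarize u x - R.polarize u y‖ₑ ^ p +
        ‖R.polarize u (R.refl x) - R.polarize u (R.refl y)‖ₑ ^ p ≤
      ‖u x - u y‖ₑ ^ p + ‖u (R.refl x) - u (R.refl y)‖ₑ ^ p := by
    have e : ∀ x, (x ∈ R.side ∨ R.refl x = x) →
        R.polarize u x = max (u x) (u (R.refl x)) ∧
        R.polarize u (R.refl x) = min (u x) (u (R.refl x)) := by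
      rintro x (h | h)
      · exact ⟨R.polarize_of_mem h, R.polarize_refl_of_mem h⟩
      · simp [h, R.polarize_of_refl_eq h]
    intro x y hx hy
    rw [(e x hx).1, (e x hx).2, (e y hy).1, (e y hy).2]
    exact enorm_sub_rpow_max_min_le hp _ _ _ _
  have cross : ∀ x y, y = R.refl x →
      ‖R.polarize u x - R.polarize u y‖ₑ ^ p +
        ‖R.polarize u (R.refl x) - R.polarize u (R.refl y)‖ₑ ^ p ≤
      ‖u x - u y‖ₑ ^ p + ‖u (R.refl x) - u (R.refl y)‖ₑ ^ p := by
    rintro x _ rfl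
    rw [R.refl_refl, enorm_sub_rev (R.polarize u (R.refl x)), enorm_sub_rev (u (R.refl x))]
    rcases R.polarize_pair u x with ⟨h1, h2⟩ | ⟨h1, h2⟩ <;> rw [h1, h2]
    rw [enorm_sub_rev]
  by_cases hx : x ∈ R.side <;> by_cases hy : y ∈ R.side
  · exact main x y (.inl hx) (.inl hy)
  · rcases R.crossing x y hxy hx hy with h | h
    · exact cross x y h
    · exact main x y (.inl hx) (.inr h)
  · rcases R.crossing y x hxy.symm hy hx with h | h
    · exact cross x y (by rw [h, R.refl_refl])
    · exact main x y (.inr h) (.inl hy)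
  · have := main (R.refl x) (R.refl y) (R.refl_mem_or_eq x hx |>.imp_right fun h => by rw [h, h])
      (R.refl_mem_or_eq y hy |>.imp_right fun h => by rw [h, h])
    rw [R.refl_refl, R.refl_refl] at this
    rwa [add_comm, add_comm (‖u x - u y‖ₑ ^ p)]

theorem edgeEnergy_polarize_le {p : ℝ} (hp : 1 ≤ p) (u : V → ℝ) :
    edgeEnergy G p (R.polarize u) ≤ edgeEnergy G p u := by
  let ρ : G.Dart → G.Dart := fun a => ⟨(R.refl a.fst, R.refl a.snd), R.adj_refl _ _ a.adj⟩
  have hρ : Function.Involutive ρ := fun a => by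
    ext <;> exact R.refl_refl _
  exact tsum_le_tsum_of_involutive hρ fun a => R.polarize_edge_le hp u a.adj

theorem support_polarize_finite {u : V → ℝ} (hu : (Function.support u).Finite) :
    (Function.support (R.polarize u)).Finite := by
  refine (hu.union (hu.image R.refl)).subset fun x hx => ?_
  rcases R.polarize_eq_or u x with h | h
  · exact .inl (by rwa [Function.mem_support, ← h])
  · exact .inr ⟨R.refl x, by rwa [Function.mem_support, ← h], R.refl_refl x⟩

/-- If some value is on the wrong side, then polarization strictly decreases the sum of `W`,
weighted by a monotone natural number valued function `k` of the values. -/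
theorem finsum_weight_polarize_lt {k : ℝ → ℕ} (hk : Monotone k) (hk0 : k 0 = 0) {u : V → ℝ}
    (hu : (Function.support u).Finite) {x₀ : V} (hx₀ : x₀ ∈ R.side)
    (hlt : k (u x₀) < k (u (R.refl x₀))) :
    ∑ᶠ x, W x * k (R.polarize u x) < ∑ᶠ x, W x * k (u x) := by
  classical
  have fin : ∀ v : V → ℝ, (Function.support v).Finite →
      (Function.support fun x => W x * k (v x)).Finite := fun v hv =>
    hv.subset fun x hx hv0 => hx (by simp [hv0, hk0])
  have fin' : ∀ v : V → ℝ, (Function.support v).Finite →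
      (Function.support fun x => W (R.refl x) * k (v (R.refl x))).Finite := fun v hv =>
    (fin v hv).preimage (Function.Involutive.injective R.refl_refl).injOn
  have two : ∀ v : V → ℝ, (Function.support v).Finite →
      ∑ᶠ x, (W x * k (v x) + W (R.refl x) * k (v (R.refl x))) = 2 * ∑ᶠ x, W x * k (v x) := by
    intro v hv
    rw [finsum_add_distrib (fin v hv) (fin' v hv), two_mul]
    congr 1
    exact finsum_comp_equiv (Function.Involutive.toPerm R.refl R.refl_refl)
      (f := fun x => W x * k (v x))
  have hle : ∀ x, W x * k (R.polarize u x) + W (R.refl x) * k (R.polarize u (R.refl x)) ≤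
      W x * k (u x) + W (R.refl x) * k (u (R.refl x)) := by
    have h1 : ∀ x ∈ R.side,
        W x * k (R.polarize u x) + W (R.refl x) * k (R.polarize u (R.refl x)) ≤
        W x * k (u x) + W (R.refl x) * k (u (R.refl x)) := fun x hx => by
      rw [R.polarize_of_mem hx, R.polarize_refl_of_mem hx]
      have hW := (R.weight_lt x hx).le
      rcases le_total (u x) (u (R.refl x)) with h | h
      · rw [max_eq_right h, min_eq_left h]
        nlinarith [hk h]
      · rw [max_eq_left h, min_eq_right h]
    intro x
    by_cases hx : x ∈ R.side
    · exact h1 x hx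
    · rcases R.refl_mem_or_eq x hx with h | h
      · have := h1 _ h
        rw [R.refl_refl] at this
        linarith
      · simp [h, R.polarize_of_refl_eq h]
  have hstrict : W x₀ * k (R.polarize u x₀) + W (R.refl x₀) * k (R.polarize u (R.refl x₀)) <
      W x₀ * k (u x₀) + W (R.refl x₀) * k (u (R.refl x₀)) := by
    rw [R.polarize_of_mem hx₀, R.polarize_refl_of_mem hx₀]
    have hW := R.weight_lt x₀ hx₀
    have h : u x₀ ≤ u (R.refl x₀) := le_of_not_ge fun h => (hk h).not_gt hlt
    rw [max_eq_right h, min_eq_left h]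
    nlinarith
  have hv := R.support_polarize_finite hu
  have h2 : 2 * ∑ᶠ x, W x * k (R.polarize u x) < 2 * ∑ᶠ x, W x * k (u x) := by
    rw [← two _ hv, ← two _ hu]
    have f1 : ∀ v : V → ℝ, (Function.support v).Finite → (Function.support fun x =>
        W x * k (v x) + W (R.refl x) * k (v (R.refl x))).Finite := fun v hv =>
      ((fin v hv).union (fin' v hv)).subset (Function.support_add _ _)
    let S := (f1 _ hv).toFinset ∪ (f1 _ hu).toFinset
    rw [finsum_eq_sum_of_support_subset (s := S) _ (fun x hx =>
        Finset.mem_coe.2 (Finset.mem_union_left _ ((f1 _ hv).mem_toFinset.2 hx))),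
      finsum_eq_sum_of_support_subset (s := S) _ (fun x hx =>
        Finset.mem_coe.2 (Finset.mem_union_right _ ((f1 _ hu).mem_toFinset.2 hx)))]
    refine Finset.sum_lt_sum (fun x _ => hle x) ⟨x₀, ?_, hstrict⟩
    refine Finset.mem_union_right _ ?_
    simp only [Set.Finite.mem_toFinset, Function.mem_support]
    omega
  omega

end Folding

/-- Every nonnegative finitely supported function has a rearrangement of no larger energy which is
fixed by all the given polarizations. Among all candidates whose values are values of `u`, one takes
the candidate that minimizes the `W`-weighted sum of the ordinal numbers of its values. -/
theorem exists_folded {V ι : Type*} {G : SimpleGraph V} {W : V → ℕ} (R : ι → Folding G W)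
    {p : ℝ} (hp : 1 ≤ p) (q : ℝ) {u : V → ℝ} (hu0 : ∀ x, 0 ≤ u x)
    (hu : (Function.support u).Finite) :
    ∃ v : V → ℝ, (∀ x, 0 ≤ v x) ∧ (Function.support v).Finite ∧ powerSum q v = powerSum q u ∧
      edgeEnergy G p v ≤ edgeEnergy G p u ∧
      ∀ i, ∀ x ∈ (R i).side, v ((R i).refl x) ≤ v x := by
  classical
  have hF : (Set.range u).Finite := by
    refine ((hu.image u).union (Set.finite_singleton 0)).subset ?_
    rintro _ ⟨x, rfl⟩
    by_cases h : u x = 0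
    · exact .inr h
    · exact .inl ⟨x, h, rfl⟩
  let k : ℝ → ℕ := fun a => (hF.toFinset.filter (· < a)).card
  have hk : Monotone k := fun a b hab => Finset.card_le_card
    fun t ht => by
      simp only [Finset.mem_filter] at ht ⊢
      exact ⟨ht.1, ht.2.trans_le hab⟩
  have hk0 : k 0 = 0 := by
    simp only [k, Finset.card_eq_zero, Finset.filter_eq_empty_iff]
    intro t ht
    obtain ⟨x, rfl⟩ := (hF.mem_toFinset).1 ht
    exact (hu0 x).not_gt
  have hks : ∀ a ∈ Set.range u, ∀ b, a < b → k a < k b := fun a ha b hab => by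
    refine Finset.card_lt_card (Finset.ssubset_iff_of_subset ?_ |>.2 ⟨a, ?_, ?_⟩)
    · intro t ht
      simp only [Finset.mem_filter] at ht ⊢
      exact ⟨ht.1, ht.2.trans hab⟩
    · simp only [Finset.mem_filter]
      exact ⟨hF.mem_toFinset.2 ha, hab⟩
    · simp
  let C : Set (V → ℝ) := {v | (Function.support v).Finite ∧ Set.range v ⊆ Set.range u ∧
    powerSum q v = powerSum q u ∧ edgeEnergy G p v ≤ edgeEnergy G p u}
  obtain ⟨v, hvC, hmin⟩ := (measure fun v : V → ℝ => ∑ᶠ x, W x * k (v x)).wf.has_min C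
    ⟨u, hu, subset_rfl, rfl, le_rfl⟩
  obtain ⟨hv, hvr, hvq, hvp⟩ := hvC
  refine ⟨v, fun x => ?_, hv, hvq, hvp, fun i x hx => ?_⟩
  · obtain ⟨y, hy⟩ := hvr ⟨x, rfl⟩
    exact hy ▸ hu0 y
  · by_contra! hlt
    refine hmin ((R i).polarize v) ⟨(R i).support_polarize_finite hv, ?_, ?_, ?_⟩
      ((R i).finsum_weight_polarize_lt hk hk0 hv hx (hks _ (hvr ⟨x, rfl⟩) _ hlt))
    · rintro _ ⟨y, rfl⟩
      rcases (R i).polarize_eq_or v y with h | h <;> rw [h] <;> exact hvr ⟨_, rfl⟩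
    · rw [(R i).powerSum_polarize, hvq]
    · exact ((R i).edgeEnergy_polarize_le hp v).trans hvp

/-! ### Reflections of the lattice -/

namespace Direction

variable {d : ℕ}

/-- The primitive lattice vector parallel to a direction. -/
def step : Direction d → Lattice d
  | .axis i => Pi.single i 1
  | .plus i j _ => Pi.single i 1 + Pi.single j 1
  | .minus i j _ => Pi.single i 1 - Pi.single j 1

/-- The integer `⟨2e, x⟩`, twice the position of `x` on its line. -/
def level (e : Direction d) (x : Lattice d) : ℤ := ∑ k, e.twice k * x k

/-- The reflection of the lattice which maps the level `t` to `2m - t`. -/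
def mirror (e : Direction d) (m : ℤ) (x : Lattice d) : Lattice d := x - (e.level x - m) • e.step

theorem level_add (e : Direction d) (x y : Lattice d) :
    e.level (x + y) = e.level x + e.level y := by
  simp [level, mul_add, Finset.sum_add_distrib]

theorem level_smul (e : Direction d) (c : ℤ) (x : Lattice d) :
    e.level (c • x) = c * e.level x := by
  simp only [level, Finset.mul_sum, Pi.smul_apply, smul_eq_mul]
  exact Finset.sum_congr rfl fun k _ => by ring

theorem level_sub (e : Direction d) (x y : Lattice d) :
    e.level (x - y) = e.level x - e.level y := by
  simp [level, mul_sub, Finset.sum_sub_distrib]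

theorem level_axis (i : Fin d) (x : Lattice d) : (axis i).level x = 2 * x i := by
  simp [level, twice, Pi.single_apply]

theorem level_plus (i j : Fin d) (h : i < j) (x : Lattice d) :
    (plus i j h).level x = x i + x j := by
  simp [level, twice, Pi.single_apply, add_mul, Finset.sum_add_distrib]

theorem level_minus (i j : Fin d) (h : i < j) (x : Lattice d) :
    (minus i j h).level x = x i - x j := by
  simp [level, twice, Pi.single_apply, sub_mul, Finset.sum_sub_distrib]

theorem level_step (e : Direction d) : e.level e.step = 2 := by
  cases e with
  | axis i => simp [level_axis, step]
  | plus i j h => simp [level_plus, step, h.ne, h.ne']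
  | minus i j h => simp [level_minus, step, h.ne, h.ne']

theorem level_mirror (e : Direction d) (m : ℤ) (x : Lattice d) :
    e.level (e.mirror m x) = 2 * m - e.level x := by
  rw [mirror, level_sub, level_smul, level_step]
  ring

theorem mirror_mirror (e : Direction d) (m : ℤ) (x : Lattice d) :
    e.mirror m (e.mirror m x) = x := by
  rw [mirror, level_mirror, mirror]
  module

theorem mirror_eq_self (e : Direction d) {m : ℤ} {x : Lattice d} (h : e.level x = m) :
    e.mirror m x = x := by
  simp [mirror, h]

/-- The linear part of the reflection sends unit vectors to unit vectors. -/
theorem exists_reflect_single (e : Direction d) (k : Fin d) :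
    ∃ l : Fin d, (Pi.single k 1 : Lattice d) - e.level (Pi.single k 1) • e.step = Pi.single l 1 ∨
      (Pi.single k 1 : Lattice d) - e.level (Pi.single k 1) • e.step = -Pi.single l 1 := by
  cases e with
  | axis i =>
    by_cases h : k = i
    · subst h
      refine ⟨k, .inr ?_⟩
      rw [level_axis, step, Pi.single_eq_same]
      module
    · refine ⟨k, .inl ?_⟩
      rw [level_axis, Pi.single_eq_of_ne (Ne.symm h)]
      module
  | plus i j hij =>
    rw [level_plus, step]
    by_cases hi : k = i
    · subst hi
      refine ⟨j, .inr ?_⟩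
      rw [Pi.single_eq_same, Pi.single_eq_of_ne hij.ne']
      module
    · by_cases hj : k = j
      · subst hj
        refine ⟨i, .inr ?_⟩
        rw [Pi.single_eq_same, Pi.single_eq_of_ne hij.ne]
        module
      · refine ⟨k, .inl ?_⟩
        rw [Pi.single_eq_of_ne (Ne.symm hi), Pi.single_eq_of_ne (Ne.symm hj)]
        module
  | minus i j hij =>
    rw [level_minus, step]
    by_cases hi : k = i
    · subst hi
      refine ⟨j, .inl ?_⟩
      rw [Pi.single_eq_same, Pi.single_eq_of_ne hij.ne']
      module
    · by_cases hj : k = j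
      · subst hj
        refine ⟨i, .inl ?_⟩
        rw [Pi.single_eq_same, Pi.single_eq_of_ne hij.ne]
        module
      · refine ⟨k, .inl ?_⟩
        rw [Pi.single_eq_of_ne (Ne.symm hi), Pi.single_eq_of_ne (Ne.symm hj)]
        module

theorem mirror_add (e : Direction d) (m : ℤ) (x y : Lattice d) :
    e.mirror m (x + y) = e.mirror m x + (y - e.level y • e.step) := by
  rw [mirror, level_add, mirror]
  module

theorem mirror_adj (e : Direction d) (m : ℤ) {x y : Lattice d} (h : (latticeGraph d).Adj x y) :
    (latticeGraph d).Adj (e.mirror m x) (e.mirror m y) := by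
  have key : ∀ (y : Lattice d) (k : Fin d),
      (latticeGraph d).Adj (e.mirror m (y + Pi.single k 1)) (e.mirror m y) := fun y k => by
    rw [mirror_add]
    obtain ⟨l, hl | hl⟩ := e.exists_reflect_single k <;> rw [hl]
    · exact ⟨l, .inl rfl⟩
    · exact ⟨l, .inr (by abel)⟩
  obtain ⟨k, rfl | h⟩ := h
  · exact key y k
  · obtain rfl : y = x + Pi.single k 1 := by rw [h]; abel
    exact (key x k).symm

/-- An edge joins neighbouring levels, or the same level, or is parallel to the direction. -/
theorem level_adj (e : Direction d) {x y : Lattice d} (h : (latticeGraph d).Adj x y) :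
    (e.level x - e.level y).natAbs ≤ 1 ∨
      (2 ∣ e.level x ∧ (e.level x = e.level y + 2 ∧ y = x - e.step ∨
        e.level y = e.level x + 2 ∧ y = x + e.step)) := by
  obtain ⟨k, h⟩ := h
  cases e with
  | axis i =>
    simp only [level_axis, step]
    by_cases hk : k = i
    · subst hk
      refine .inr ⟨dvd_mul_right _ _, ?_⟩
      rcases h with rfl | rfl
      · exact .inl ⟨by simp; ring, by abel⟩
      · exact .inr ⟨by simp; ring, by abel⟩
    · left
      rcases h with rfl | rfl <;> simp [Pi.single_eq_of_ne (Ne.symm hk)]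
  | plus i j hij =>
    left
    rw [level_plus, level_plus]
    rcases h with rfl | rfl <;> simp only [Pi.add_apply, Pi.sub_apply, Pi.single_apply] <;>
      split_ifs <;> omega
  | minus i j hij =>
    left
    rw [level_minus, level_minus]
    rcases h with rfl | rfl <;> simp only [Pi.add_apply, Pi.sub_apply, Pi.single_apply] <;>
      split_ifs <;> omega

end Direction

/-- `(2d+1)² |x - c|²`, where the point `c = (d, d-1, …, 1) / (2d+1)` lies strictly inside the
favourable half-spaces of all reflections, so that reflecting out of such a half-space increases
the distance to `c`. -/
def centerWeight {d : ℕ} (x : Lattice d) : ℕ :=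
  (∑ k : Fin d, ((2 * d + 1) * x k - (d - k : ℤ)) ^ 2).toNat

namespace Direction

variable {d : ℕ}

/-- The vectors `step` and `twice` are parallel; the factor follows from `⟨2e, step⟩ = 2`. -/
theorem two_mul_sum_step (e : Direction d) (z : Fin d → ℤ) :
    2 * ∑ k, e.step k * z k = (∑ k, e.step k ^ 2) * e.level z := by
  cases e with
  | axis i => simp [level_axis, step, Pi.single_apply]
  | plus i j h =>
    have h1 : ∀ k : Fin d, (Pi.single i 1 + Pi.single j 1 : Lattice d) k ^ 2 =
        (Pi.single i 1 : Lattice d) k + (Pi.single j 1 : Lattice d) k := fun k => by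
      simp only [Pi.add_apply, Pi.single_apply]
      have := h.ne
      split_ifs <;> first | rfl | (exfalso; apply this; simp_all)
    simp only [step, h1]
    simp [level_plus, Pi.single_apply, add_mul, Finset.sum_add_distrib]
  | minus i j h =>
    have h1 : ∀ k : Fin d, (Pi.single i 1 - Pi.single j 1 : Lattice d) k ^ 2 =
        (Pi.single i 1 : Lattice d) k + (Pi.single j 1 : Lattice d) k := fun k => by
      simp only [Pi.sub_apply, Pi.single_apply]
      have := h.ne
      split_ifs <;> first | rfl | (exfalso; apply this; simp_all)
    simp only [step, h1]
    simp [level_minus, Pi.single_apply, sub_mul, Finset.sum_add_distrib, Finset.sum_sub_distrib]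

theorem sum_step_sq_pos (e : Direction d) : 0 < ∑ k, e.step k ^ 2 := by
  refine (Finset.sum_nonneg fun k _ => sq_nonneg _).lt_of_ne fun h => ?_
  have h0 : e.step = 0 := by
    funext k
    have := (Finset.sum_eq_zero_iff_of_nonneg fun k _ => sq_nonneg (e.step k)).1 h.symm k
      (Finset.mem_univ k)
    exact pow_eq_zero_iff two_ne_zero |>.1 this
  have := e.level_step
  rw [h0] at this
  simp [level] at this

/-- The point `c` of `centerWeight` has a level strictly between `0` and `1`, that is, strictly
between the mirrors, in every direction. -/
theorem level_center_mem (e : Direction d) :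
    0 < e.level (fun k : Fin d => (d - k : ℤ)) ∧
      e.level (fun k : Fin d => (d - k : ℤ)) < 2 * d + 1 := by
  cases e with
  | axis i => rw [level_axis]; have := i.2; constructor <;> omega
  | plus i j h =>
    rw [level_plus]
    have := i.2
    have := j.2
    have : (i : ℕ) < j := h
    constructor <;> omega
  | minus i j h =>
    rw [level_minus]
    have := i.2
    have := j.2
    have : (i : ℕ) < j := h
    constructor <;> omega

theorem centerWeight_mirror_lt (e : Direction d) {m : ℤ} {x : Lattice d}
    (h : m = 0 ∧ 0 < e.level x ∨ m = 1 ∧ e.level x < 1) :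
    centerWeight x < centerWeight (e.mirror m x) := by
  set c : Fin d → ℤ := fun k => d - k with hc
  set N : ℤ := 2 * d + 1 with hN
  set t := e.level x with ht
  have key : 2 * (∑ k : Fin d, (N * e.mirror m x k - c k) ^ 2 - ∑ k, (N * x k - c k) ^ 2) =
      2 * ((∑ k, e.step k ^ 2) * N * ((t - m) * (e.level c - N * m))) := by
    have h1 : ∑ k : Fin d, (N * e.mirror m x k - c k) ^ 2 - ∑ k, (N * x k - c k) ^ 2 =
        N ^ 2 * (t - m) ^ 2 * ∑ k, e.step k ^ 2 - 2 * N ^ 2 * (t - m) * ∑ k, e.step k * x k +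
          2 * N * (t - m) * ∑ k, e.step k * c k := by
      rw [← Finset.sum_sub_distrib]
      simp only [Finset.mul_sum]
      rw [← Finset.sum_sub_distrib, ← Finset.sum_add_distrib]
      refine Finset.sum_congr rfl fun k _ => ?_
      simp only [mirror, Pi.sub_apply, Pi.smul_apply, smul_eq_mul]
      ring
    have h2 := e.two_mul_sum_step x
    have h3 := e.two_mul_sum_step c
    rw [h1]
    linear_combination (-2 * N ^ 2 * (t - m)) * h2 + 2 * N * (t - m) * h3
  obtain ⟨c0, c1⟩ := e.level_center_mem
  have hpos : 0 < (t - m) * (e.level c - N * m) := by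
    rcases h with ⟨rfl, h⟩ | ⟨rfl, h⟩
    · simpa using mul_pos h c0
    · exact mul_pos_of_neg_of_neg (by linarith) (by linarith)
  have h4 : 0 < (∑ k, e.step k ^ 2) * N * ((t - m) * (e.level c - N * m)) :=
    mul_pos (mul_pos e.sum_step_sq_pos (by omega)) hpos
  have h5 : 0 ≤ ∑ k, (N * x k - c k) ^ 2 := Finset.sum_nonneg fun k _ => sq_nonneg _
  unfold centerWeight
  rw [Int.toNat_lt_toNat (by linarith)]
  linarith

/-- The reflection of a line at the level `0` (`b = false`), preferring positive levels, or at the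
level `1` (`b = true`), preferring the levels below `1`. Applying these two reflections in turn,
starting with the appropriate one, runs through the places on the line in the order in which the
rearrangement `R_e` fills them. -/
def folding (e : Direction d) (b : Bool) : Folding (latticeGraph d) centerWeight where
  refl := e.mirror (if b then 1 else 0)
  side := {x | if b then e.level x < 1 else 0 < e.level x}
  refl_refl := e.mirror_mirror _
  adj_refl _ _ := e.mirror_adj _
  refl_notMem x hx := by
    cases b <;> simp [level_mirror] at hx ⊢ <;> omega
  refl_mem_or_eq x hx := by
    have : e.level x = (if b then 1 else 0) ∨ e.level x ≠ (if b then 1 else 0) := em _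
    rcases this with h | h
    · exact .inr (e.mirror_eq_self h)
    · left
      cases b <;> simp [level_mirror] at hx h ⊢ <;> omega
  crossing x y hxy hx hy := by
    have := e.level_adj hxy
    cases b
    · simp only [Bool.false_eq_true, if_false, Set.mem_ofPred_eq, not_lt] at *
      exact .inr (e.mirror_eq_self (by omega))
    · simp only [if_true, Set.mem_ofPred_eq, not_lt] at *
      by_cases hy1 : e.level y = 1
      · exact .inr (e.mirror_eq_self hy1)
      · left
        rcases this with h | ⟨_, ⟨_, _⟩ | ⟨h, rfl⟩⟩
        · omega
        · omega
        · rw [mirror, show e.level x = 0 by omega]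
          module
  weight_lt x hx := by
    apply centerWeight_mirror_lt
    cases b <;> simp at hx ⊢ <;> exact hx

end Direction

/-! ### Functions fixed by all polarizations are Schwarz symmetric -/

/-- `u` is fixed by all polarizations: it is nowhere larger at the mirror image of a point than at
the point, if the point is on the favourable side. -/
def Folded {d : ℕ} (u : Lattice d → ℝ) : Prop :=
  ∀ (e : Direction d) (b : Bool), ∀ x ∈ (e.folding b).side, u ((e.folding b).refl x) ≤ u x

namespace Direction

variable {d : ℕ} (e : Direction d)

/-- The real multiples of `e` in the definition of a line are integer multiples of `step`. -/
theorem mem_line_iff {x y : Lattice d} : y ∈ e.line x ↔ ∃ c : ℤ, y = x + c • e.step := by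
  constructor
  · rintro ⟨c, hc⟩
    have hc' : ∀ k, (y k : ℝ) = x k + c * (e.twice k : ℝ) := fun k => by
      have := hc k
      push_cast at this
      linarith
    have fin : ∀ n : ℤ, (∀ k, (n : ℝ) * e.step k = c * e.twice k) → y = x + n • e.step := by
      intro n hn
      funext k
      have := hc' k
      rw [← hn] at this
      simp only [Pi.add_apply, Pi.smul_apply, smul_eq_mul]
      exact_mod_cast this
    cases e with
    | axis i =>
      refine ⟨_, fin (y i - x i) fun k => ?_⟩
      have := hc i
      rw [this]
      by_cases h : k = i
      · subst h
        simp [twice, step]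
      · simp [twice, step, h]
    | plus i j h =>
      refine ⟨_, fin (y i - x i) fun k => ?_⟩
      have := hc i
      rw [this]
      simp [twice, step, h.ne]
    | minus i j h =>
      refine ⟨_, fin (y i - x i) fun k => ?_⟩
      have := hc i
      rw [this]
      simp [twice, step, h.ne]
  · rintro ⟨n, rfl⟩
    cases e with
    | axis i =>
      refine ⟨n / 2, fun k => ?_⟩
      by_cases h : k = i
      · subst h
        simp [twice, step]
      · simp [twice, step, h]
    | plus i j h => exact ⟨n, fun k => by simp [twice, step]; ring⟩
    | minus i j h => exact ⟨n, fun k => by simp [twice, step]⟩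

theorem self_mem_line (x : Lattice d) : x ∈ e.line x := e.mem_line_iff.2 ⟨0, by simp⟩

theorem rank_pos (t : ℤ) : 1 ≤ rank t := by
  unfold rank
  split_ifs <;> omega

/-- The level of the point of rank `n` on a line whose levels have the parity of `t`. -/
def levelOfRank (t : ℤ) (n : ℕ) : ℤ := if (t - n) % 2 = 0 then n else 1 - n

theorem rank_levelOfRank (t : ℤ) {n : ℕ} (hn : 1 ≤ n) : rank (levelOfRank t n) = n := by
  unfold rank levelOfRank
  split_ifs <;> omega

theorem levelOfRank_rank {t s : ℤ} (h : (s - t) % 2 = 0) : levelOfRank t (rank s) = s := by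
  unfold rank levelOfRank
  split_ifs <;> omega

/-- The point of rank `n` on the line of `x`. -/
def point (x : Lattice d) (n : ℕ) : Lattice d :=
  x + ((levelOfRank (e.level x) n - e.level x) / 2) • e.step

theorem level_point (x : Lattice d) (n : ℕ) :
    e.level (e.point x n) = levelOfRank (e.level x) n := by
  rw [point, level_add, level_smul, level_step, Int.ediv_mul_cancel]
  · ring
  · unfold levelOfRank
    split_ifs <;> omega

theorem point_mem_line (x : Lattice d) (n : ℕ) : e.point x n ∈ e.line x :=
  e.mem_line_iff.2 ⟨_, rfl⟩

theorem eq_of_mem_line {x y z : Lattice d} (hy : y ∈ e.line x) (hz : z ∈ e.line x)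
    (h : e.level y = e.level z) : y = z := by
  obtain ⟨a, rfl⟩ := e.mem_line_iff.1 hy
  obtain ⟨b, rfl⟩ := e.mem_line_iff.1 hz
  simp only [level_add, level_smul, level_step] at h
  rw [show a = b by omega]

theorem point_rank {x y : Lattice d} (hy : y ∈ e.line x) : e.point x (rank (e.level y)) = y := by
  refine e.eq_of_mem_line (e.point_mem_line _ _) hy ?_
  rw [level_point]
  obtain ⟨a, rfl⟩ := e.mem_line_iff.1 hy
  apply levelOfRank_rank
  simp only [level_add, level_smul, level_step]
  omega

theorem rank_level_point (x : Lattice d) {n : ℕ} (hn : 1 ≤ n) :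
    rank (e.level (e.point x n)) = n := by
  rw [level_point, rank_levelOfRank _ hn]

/-- Consecutive points in the filling order are mirror images of each other. -/
theorem point_succ_le {u : Lattice d → ℝ} (hu : Folded u) (x : Lattice d) {n : ℕ} (hn : 1 ≤ n) :
    u (e.point x (n + 1)) ≤ u (e.point x n) := by
  have hl := e.level_point x n
  have hl' := e.level_point x (n + 1)
  have hline : ∀ m, e.mirror m (e.point x n) ∈ e.line x := fun m => by
    obtain ⟨c, hc⟩ := e.mem_line_iff.1 (e.point_mem_line x n)
    refine e.mem_line_iff.2 ⟨c - (e.level (e.point x n) - m), ?_⟩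
    rw [mirror, hc]
    module
  have heq : ∀ m, levelOfRank (e.level x) (n + 1) = 2 * m - levelOfRank (e.level x) n →
      e.point x (n + 1) = e.mirror m (e.point x n) := fun m hm =>
    e.eq_of_mem_line (e.point_mem_line _ _) (hline m) (by rw [level_mirror, hl, hl', hm])
  by_cases ht : 0 < e.level (e.point x n)
  · rw [heq 0]
    · exact hu e false _ (by simpa [folding] using ht)
    · rw [hl] at ht
      unfold levelOfRank at ht ⊢
      split_ifs at ht ⊢ <;> omega
  · rw [heq 1]
    · exact hu e true _ (by simp only [folding, if_true, Set.mem_ofPred_eq]; omega)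
    · rw [hl] at ht
      unfold levelOfRank at ht ⊢
      split_ifs at ht ⊢ <;> omega

theorem point_antitone {u : Lattice d → ℝ} (hu : Folded u) (x : Lattice d) {m n : ℕ} (hm : 1 ≤ m)
    (hmn : m ≤ n) : u (e.point x n) ≤ u (e.point x m) := by
  induction n, hmn using Nat.le_induction with
  | base => rfl
  | succ n hn ih => exact (e.point_succ_le hu x (hm.trans hn)).trans ih

theorem point_injOn (x : Lattice d) : Set.InjOn (e.point x) {n | 1 ≤ n} := fun m hm n hn h => by
  rw [← e.rank_level_point x hm, h, e.rank_level_point x hn]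

theorem card_image_point (x : Lattice d) (n : ℕ) :
    ((Finset.Icc 1 n).image (e.point x)).card = n := by
  rw [Finset.card_image_of_injOn, Nat.card_Icc, Nat.add_sub_cancel]
  exact (e.point_injOn x).mono fun k hk => (Finset.mem_Icc.1 hk).1

end Direction

/-- On each line a folded function is decreasing in the rank, so that its value at rank `n` is its
`n`-th largest value. -/
theorem oneStep_eq_self {d : ℕ} (e : Direction d) {u : Lattice d → ℝ} (hu : Folded u) :
    oneStep e u = u := by
  classical
  funext x
  set n := rank (e.level x) with hn
  have hn1 : 1 ≤ n := Direction.rank_pos _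
  have hx : e.point x n = x := e.point_rank (e.self_mem_line x)
  refine IsGreatest.csSup_eq (a := u x) ⟨?_, ?_⟩
  · have hne : ((Finset.Icc 1 n).image (e.point x)).Nonempty :=
      (Finset.nonempty_Icc.2 hn1).image _
    refine ⟨_, hne, ?_, e.card_image_point x n, ?_⟩
    · simp only [Finset.coe_image, Set.image_subset_iff]
      exact fun k _ => e.point_mem_line x k
    · refine le_antisymm ?_ ?_
      · refine Finset.le_inf' _ _ fun y hy => ?_
        obtain ⟨k, hk, rfl⟩ := Finset.mem_image.1 hy
        rw [Finset.mem_Icc] at hk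
        conv_lhs => rw [← hx]
        exact e.point_antitone hu x hk.1 hk.2
      · refine Finset.inf'_le _ (Finset.mem_image.2 ⟨n, Finset.mem_Icc.2 ⟨hn1, le_rfl⟩, hx⟩)
  · rintro t ⟨Ω, hΩ, hL, hcard, rfl⟩
    -- Not all elements of `Ω` can have a rank below `n`.
    obtain ⟨y, hy, hyn⟩ : ∃ y ∈ Ω, n ≤ rank (e.level y) := by
      by_contra! hlt
      have hsub : Ω ⊆ (Finset.Icc 1 (n - 1)).image (e.point x) := fun y hy =>
        Finset.mem_image.2 ⟨rank (e.level y), Finset.mem_Icc.2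
          ⟨Direction.rank_pos _, Nat.le_sub_one_of_lt (hlt y hy)⟩, e.point_rank (hL hy)⟩
      have := Finset.card_le_card hsub
      rw [e.card_image_point] at this
      have hc : Ω.card = n := hcard
      omega
    refine (Finset.inf'_le _ hy).trans ?_
    rw [← e.point_rank (hL hy)]
    conv_rhs => rw [← hx]
    exact e.point_antitone hu x hn1 hyn

theorem schwarzSymmetric_of_folded {d : ℕ} {u : Lattice d → ℝ} (ha : Admissible u)
    (hu : Folded u) : SchwarzSymmetric u := by
  refine ⟨ha, fun n σ _ x => ?_⟩
  have : ∀ k, iterStep σ k u = u := fun k => by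
    induction k with
    | zero => rfl
    | succ k ih => rw [iterStep, ih, oneStep_eq_self _ hu]
  simp only [this]
  exact tendsto_const_nhds

/-- The decay of folded functions: at least `2 |x_i|` points of the axis-parallel line through `x`
carry a value which is not smaller than `u x`. -/
theorem Folded.natAbs_mul_le_powerSum {d : ℕ} {u : Lattice d → ℝ} (hu : Folded u)
    (h0 : ∀ x, 0 ≤ u x) {r : ℝ} (hr : 0 ≤ r) (x : Lattice d) (i : Fin d) :
    (x i).natAbs * ‖u x‖ₑ ^ r ≤ powerSum r u := by
  classical
  set e : Direction d := .axis i with he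
  set n := rank (e.level x) with hn
  have hx : e.point x n = x := e.point_rank (e.self_mem_line x)
  have hni : (x i).natAbs ≤ n := by
    rw [hn, he, Direction.level_axis, rank]
    split_ifs <;> omega
  calc (x i).natAbs * ‖u x‖ₑ ^ r ≤ n * ‖u x‖ₑ ^ r := by gcongr
    _ = ∑ y ∈ (Finset.Icc 1 n).image (e.point x), ‖u x‖ₑ ^ r := by
      rw [Finset.sum_const, e.card_image_point, nsmul_eq_mul]
    _ ≤ ∑ y ∈ (Finset.Icc 1 n).image (e.point x), ‖u y‖ₑ ^ r := by
      refine Finset.sum_le_sum fun y hy => ?_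
      obtain ⟨k, hk, rfl⟩ := Finset.mem_image.1 hy
      rw [Finset.mem_Icc] at hk
      have := e.point_antitone hu x hk.1 hk.2
      rw [hx] at this
      refine ENNReal.rpow_le_rpow ?_ hr
      rw [Real.enorm_of_nonneg (h0 _), Real.enorm_of_nonneg (h0 _)]
      exact ENNReal.ofReal_le_ofReal this
    _ ≤ powerSum r u := ENNReal.sum_le_tsum _

/-! ### The discrete Sobolev inequality -/

theorem powerSum_ne_top {V : Type*} {q : ℝ} (hq : 0 < q) {u : V → ℝ}
    (hu : (Function.support u).Finite) : powerSum q u ≠ ∞ := by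
  rw [powerSum, tsum_eq_sum (s := hu.toFinset)]
  · exact (ENNReal.sum_lt_top.2 fun x _ => ENNReal.rpow_lt_top_of_nonneg hq.le enorm_ne_top).ne
  · intro x hx
    have : u x = 0 := by simpa using hx
    simp [this, hq]

/-- The grid-lines lemma of Mathlib for the counting measure on `ℤ^d`. -/
theorem gridlines_count {d : ℕ} (hd : 2 ≤ d) (D : Lattice d → ℝ≥0∞) :
    ∑' x : Lattice d, ∏ i, (∑' s : ℤ, D (Function.update x i s)) ^ ((1 : ℝ) / (d - 1)) ≤
      (∑' x, D x) ^ ((d : ℝ) / (d - 1)) := by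
  have hd1 : (1 : ℝ) < d := by exact_mod_cast hd
  have hpi : MeasureTheory.Measure.pi
      (fun _ : Fin d => (MeasureTheory.Measure.count : MeasureTheory.Measure ℤ)) =
      MeasureTheory.Measure.count := by
    refine MeasureTheory.Measure.ext_of_singleton fun x => ?_
    rw [MeasureTheory.Measure.pi_singleton]
    simp
  have hc : Real.HolderConjugate (Fintype.card (Fin d)) ((d : ℝ) / (d - 1)) := by
    rw [Fintype.card_fin]
    exact Real.HolderConjugate.conjExponent hd1
  have := MeasureTheory.lintegral_prod_lintegral_pow_le
    (fun _ : Fin d => (MeasureTheory.Measure.count : MeasureTheory.Measure ℤ)) hc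
    (f := D) (measurable_of_countable D)
  rw [hpi] at this
  simpa only [MeasureTheory.lintegral_count, Fintype.card_fin] using this

/-- A finitely supported function vanishes far away on a line, so that its value is a telescoping
sum of differences. -/
theorem enorm_le_tsum_line {d : ℕ} {f : Lattice d → ℝ} (hf : (Function.support f).Finite)
    (x : Lattice d) (i : Fin d) :
    ‖f x‖ₑ ≤ ∑' s : ℤ,
      ‖f (Function.update x i s) - f (Function.update x i s + Pi.single i 1)‖ₑ := by
  let h : ℕ → ℝ := fun k => f (Function.update x i (x i + k))
  have hinj : Function.Injective fun k : ℕ => Function.update x i (x i + k) := fun a b hab => by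
    have := congrFun hab i
    simpa using this
  obtain ⟨n, hn⟩ : ∃ n, h n = 0 := by
    by_contra! hne
    exact Set.infinite_of_injective_forall_mem hinj (fun k => hne k) hf
  have h0 : h 0 = f x := by simp [h]
  let F : ℤ → ℝ≥0∞ := fun s =>
    ‖f (Function.update x i s) - f (Function.update x i s + Pi.single i 1)‖ₑ
  have hF : ∀ k : ℕ, edist (h k) (h (k + 1)) = F (x i + k) := fun k => by
    have : Function.update x i (x i + (k + 1 : ℕ)) =
        Function.update x i (x i + k) + Pi.single i 1 := by
      funext j
      by_cases hj : j = i
      · subst hj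
        simp [add_assoc]
      · simp [hj]
    simp only [h, F, edist_eq_enorm_sub, this]
  calc ‖f x‖ₑ = edist (h 0) (h n) := by rw [hn, h0, edist_zero_right]
    _ ≤ ∑ k ∈ Finset.range n, edist (h k) (h (k + 1)) := edist_le_range_sum_edist h n
    _ = ∑ k ∈ Finset.range n, F (x i + k) := Finset.sum_congr rfl fun k _ => hF k
    _ ≤ ∑' k : ℕ, F (x i + k) := ENNReal.sum_le_tsum (f := fun k : ℕ => F (x i + k)) _
    _ ≤ ∑' s, F s := ENNReal.tsum_comp_le_tsum_of_injective (f := fun k : ℕ => x i + (k : ℤ))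
        (fun a b hab => by simpa using hab) F

/-- The case `p = 1` of the Sobolev inequality, due to Gagliardo and Nirenberg. -/
theorem powerSum_le_of_grad_one {d : ℕ} (hd : 2 ≤ d) {f : Lattice d → ℝ}
    (hf : (Function.support f).Finite) :
    powerSum ((d : ℝ) / (d - 1)) f ≤
      (∑' x, ∑ i, ‖f x - f (x + Pi.single i 1)‖ₑ) ^ ((d : ℝ) / (d - 1)) := by
  have hd1 : (0 : ℝ) < d - 1 := by
    have : (1 : ℝ) < d := by exact_mod_cast hd
    linarith
  refine le_trans (ENNReal.tsum_le_tsum fun x => ?_) (gridlines_count hd _)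
  calc ‖f x‖ₑ ^ ((d : ℝ) / (d - 1)) = ∏ _i : Fin d, ‖f x‖ₑ ^ ((1 : ℝ) / (d - 1)) := by
        rw [Finset.prod_const, Finset.card_univ, Fintype.card_fin, ← ENNReal.rpow_natCast,
          ← ENNReal.rpow_mul]
        congr 1
        ring
    _ ≤ _ := by
        refine Finset.prod_le_prod' fun i _ => ?_
        refine ENNReal.rpow_le_rpow ((enorm_le_tsum_line hf x i).trans ?_) (by positivity)
        exact ENNReal.tsum_le_tsum fun s => Finset.single_le_sum (f := fun j =>
          ‖f (Function.update x i s) - f (Function.update x i s + Pi.single j 1)‖ₑ)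
          (fun _ _ => zero_le) (Finset.mem_univ i)

theorem rpow_sub_rpow_le {γ : ℝ} (hγ : 1 ≤ γ) {a b : ℝ} (hb : 0 ≤ b) (hab : b ≤ a) :
    a ^ γ - b ^ γ ≤ γ * ((a - b) * a ^ (γ - 1)) := by
  rcases (hb.trans hab).eq_or_lt with h | ha
  · obtain rfl : b = a := by linarith
    simp
  have h := one_add_mul_self_le_rpow_one_add (s := b / a - 1)
    (by linarith [div_nonneg hb ha.le]) hγ
  rw [add_sub_cancel, Real.div_rpow hb ha.le, le_div_iff₀ (Real.rpow_pos_of_pos ha γ)] at h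
  have e : a ^ γ = a * a ^ (γ - 1) := by
    rw [Real.rpow_sub_one ha.ne']
    field_simp
  have e2 : (1 + γ * (b / a - 1)) * a ^ γ = a ^ γ - γ * ((a - b) * a ^ (γ - 1)) := by
    rw [e]
    field_simp
    ring
  linarith

theorem enorm_rpow_sub_rpow_le {γ : ℝ} (hγ : 1 ≤ γ) {a b : ℝ} (ha : 0 ≤ a) (hb : 0 ≤ b) :
    ‖a ^ γ - b ^ γ‖ₑ ≤
      ENNReal.ofReal γ * (‖a - b‖ₑ * ‖a‖ₑ ^ (γ - 1) + ‖a - b‖ₑ * ‖b‖ₑ ^ (γ - 1)) := by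
  wlog hab : b ≤ a generalizing a b
  · have := this hb ha (by linarith)
    rwa [enorm_sub_rev, enorm_sub_rev a b, add_comm (‖b - a‖ₑ * _)]
  have h : ‖a ^ γ - b ^ γ‖ₑ ≤ ENNReal.ofReal γ * (‖a - b‖ₑ * ‖a‖ₑ ^ (γ - 1)) := by
    have h1 : 0 ≤ a ^ γ - b ^ γ := sub_nonneg.2 (Real.rpow_le_rpow hb hab (by linarith))
    rw [Real.enorm_of_nonneg h1, Real.enorm_of_nonneg ha,
      Real.enorm_of_nonneg (sub_nonneg.2 hab), ENNReal.ofReal_rpow_of_nonneg ha (by linarith),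
      ← ENNReal.ofReal_mul (by linarith), ← ENNReal.ofReal_mul (by linarith)]
    exact ENNReal.ofReal_le_ofReal (rpow_sub_rpow_le hγ hb hab)
  exact h.trans (by gcongr; exact le_self_add)

theorem tsum_shift_le_edgeEnergy {d : ℕ} (p : ℝ) (u : Lattice d → ℝ) (i : Fin d) :
    ∑' x, ‖u x - u (x + Pi.single i 1)‖ₑ ^ p ≤ edgeEnergy (latticeGraph d) p u := by
  let a : Lattice d → (latticeGraph d).Dart := fun x =>
    ⟨(x, x + Pi.single i 1), ⟨i, .inr (by simp)⟩⟩
  refine ENNReal.tsum_comp_le_tsum_of_injective (f := a) (fun x y h => ?_)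
    (fun a : (latticeGraph d).Dart => ‖u a.fst - u a.snd‖ₑ ^ p)
  exact congrArg (fun a : (latticeGraph d).Dart => a.fst) h

theorem tsum_rpow_mul_rpow_le {α : Type*} (f g : α → ℝ≥0∞) {s t : ℝ} (hs : 0 ≤ s)
    (ht : 0 ≤ t) (hst : s + t = 1) :
    ∑' x, f x ^ s * g x ^ t ≤ (∑' x, f x) ^ s * (∑' x, g x) ^ t := by
  let _ : MeasurableSpace α := ⊤
  have := ENNReal.lintegral_mul_norm_pow_le
    (μ := (MeasureTheory.Measure.count : MeasureTheory.Measure α)) (f := f) (g := g)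
    Measurable.of_discrete.aemeasurable Measurable.of_discrete.aemeasurable hs ht hst
  simpa only [MeasureTheory.lintegral_count] using this

/-- Hölder's inequality for the gradient of the power `u ^ γ`. -/
theorem tsum_grad_rpow_le {d : ℕ} {p γ r : ℝ} (hp1 : 1 ≤ p) (hγ1 : 1 ≤ γ)
    (er : r * (1 - 1 / p) = γ - 1) {u : Lattice d → ℝ} (hu0 : ∀ x, 0 ≤ u x) :
    ∑' x, ∑ i, ‖u x ^ γ - u (x + Pi.single i 1) ^ γ‖ₑ ≤
      d * (ENNReal.ofReal γ * 2) * edgeEnergy (latticeGraph d) p u ^ (1 / p) *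
        powerSum r u ^ (1 - 1 / p) := by
  have hp0 : 0 < p := by linarith
  have ep : p * (1 / p) = 1 := by field_simp
  have hp' : 1 / p ≤ 1 := by rw [div_le_one hp0]; exact hp1
  generalize hE : edgeEnergy (latticeGraph d) p u = E
  generalize hS : powerSum r u = S
  have holder : ∀ (i : Fin d) (g : Lattice d → ℝ), powerSum r g = S →
      ∑' x, ‖u x - u (x + Pi.single i 1)‖ₑ * ‖g x‖ₑ ^ (γ - 1) ≤ E ^ (1 / p) * S ^ (1 - 1 / p) := by
    intro i g hg
    calc ∑' x, ‖u x - u (x + Pi.single i 1)‖ₑ * ‖g x‖ₑ ^ (γ - 1)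
        = ∑' x, (‖u x - u (x + Pi.single i 1)‖ₑ ^ p) ^ (1 / p) * (‖g x‖ₑ ^ r) ^ (1 - 1 / p) := by
          refine tsum_congr fun x => ?_
          rw [← ENNReal.rpow_mul, ← ENNReal.rpow_mul, ep, er, ENNReal.rpow_one]
      _ ≤ (∑' x, ‖u x - u (x + Pi.single i 1)‖ₑ ^ p) ^ (1 / p) *
            (∑' x, ‖g x‖ₑ ^ r) ^ (1 - 1 / p) :=
          tsum_rpow_mul_rpow_le _ _ (by positivity) (by linarith) (by ring)
      _ ≤ E ^ (1 / p) * S ^ (1 - 1 / p) := by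
          rw [← hg, ← hE]
          gcongr
          · exact tsum_shift_le_edgeEnergy p u i
          · rfl
  have hshift : ∀ i : Fin d,
      powerSum r (fun x : Lattice d => u (x + Pi.single i 1)) = S := fun i => by
    rw [← hS, powerSum, powerSum,
      ← (Equiv.addRight (Pi.single i 1 : Lattice d)).tsum_eq fun x => ‖u x‖ₑ ^ r]
    rfl
  have hdir : ∀ i : Fin d, ∑' x, ‖u x ^ γ - u (x + Pi.single i 1) ^ γ‖ₑ ≤
      ENNReal.ofReal γ * (2 * (E ^ (1 / p) * S ^ (1 - 1 / p))) := fun i => by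
    refine (ENNReal.tsum_le_tsum fun x =>
      enorm_rpow_sub_rpow_le hγ1 (hu0 x) (hu0 (x + Pi.single i 1))).trans ?_
    rw [ENNReal.tsum_mul_left, ENNReal.tsum_add, two_mul]
    gcongr
    · exact holder i u hS
    · exact holder i (fun x => u (x + Pi.single i 1)) (hshift i)
  rw [Summable.tsum_finsetSum fun _ _ => ENNReal.summable]
  refine (Finset.sum_le_sum fun i _ => hdir i).trans_eq ?_
  rw [Finset.sum_const, Finset.card_univ, Fintype.card_fin, nsmul_eq_mul]
  ring

/-- The discrete Sobolev inequality `‖u‖_{p*} ≤ C ‖∇u‖_p`, where `p* = dp / (d - p)`. It follows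
from the case `p = 1`, applied to the power `γ = p (d - 1) / (d - p)` of `u`, and Hölder's
inequality. -/
theorem sobolev_inequality {d : ℕ} (hd : 2 ≤ d) {p : ℝ} (hp1 : 1 ≤ p) (hpd : p < d)
    {u : Lattice d → ℝ} (hu0 : ∀ x, 0 ≤ u x) (hu : (Function.support u).Finite) :
    powerSum (d * p / (d - p)) u ≤
      (d * (ENNReal.ofReal (p * (d - 1) / (d - p)) * 2) *
        edgeEnergy (latticeGraph d) p u ^ (1 / p)) ^ (d * p / (d - p)) := by
  have hd1 : (0 : ℝ) < d - 1 := by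
    have : (1 : ℝ) < d := by exact_mod_cast hd
    linarith
  have hdp : 0 < d - p := by linarith
  have hp0 : 0 < p := by linarith
  set γ : ℝ := p * (d - 1) / (d - p) with hγ
  set r : ℝ := d * p / (d - p) with hr
  have hγ1 : 1 ≤ γ := by rw [hγ, le_div_iff₀ hdp]; nlinarith
  have hr0 : 0 < r := by positivity
  have hStop := powerSum_ne_top hr0 hu
  have er : r * (1 - 1 / p) = γ - 1 := by rw [hr, hγ]; field_simp; ring
  have hp' : 1 / p ≤ 1 := by rw [div_le_one hp0]; exact hp1
  have hgrad := tsum_grad_rpow_le hp1 hγ1 er hu0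
  have hfs : (Function.support fun x => u x ^ γ).Finite := hu.subset fun x hx h0 => hx (by
    simp only [h0]
    exact Real.zero_rpow (by linarith))
  generalize hE : edgeEnergy (latticeGraph d) p u = E at hgrad ⊢
  generalize hS : powerSum r u = S at hgrad hStop ⊢
  have hSf : powerSum ((d : ℝ) / (d - 1)) (fun x => u x ^ γ) = S := by
    rw [← hS]
    refine tsum_congr fun x => ?_
    simp only
    rw [Real.enorm_of_nonneg (Real.rpow_nonneg (hu0 x) γ), Real.enorm_of_nonneg (hu0 x),
      ← ENNReal.ofReal_rpow_of_nonneg (hu0 x) (by linarith), ← ENNReal.rpow_mul]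
    congr 1
    rw [hr, hγ]
    field_simp
  have main := powerSum_le_of_grad_one hd hfs
  rw [hSf] at main
  set A := d * (ENNReal.ofReal γ * 2) * E ^ (1 / p) with hA
  have main' : S ≤ (A * S ^ (1 - 1 / p)) ^ ((d : ℝ) / (d - 1)) :=
    main.trans (ENNReal.rpow_le_rpow hgrad (by positivity))
  rcases eq_or_ne S 0 with hS0 | hS0
  · rw [hS0]; exact zero_le
  -- Divide by a power of `S`, which is positive and finite.
  have h1 : S ^ (((d : ℝ) - 1) / d) ≤ A * S ^ (1 - 1 / p) := by
    have := ENNReal.rpow_le_rpow main' (z := ((d : ℝ) - 1) / d) (by positivity)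
    rwa [← ENNReal.rpow_mul, div_mul_div_cancel₀ (by positivity), div_self (by positivity),
      ENNReal.rpow_one] at this
  have h2 : S ^ (1 / r) ≤ A := by
    have h3 : S ^ (((d : ℝ) - 1) / d) = S ^ (1 / r) * S ^ (1 - 1 / p) := by
      rw [← ENNReal.rpow_add _ _ hS0 hStop]
      congr 1
      rw [hr]
      field_simp
      ring
    rw [h3] at h1
    have hne : S ^ (1 - 1 / p) ≠ 0 := (ENNReal.rpow_pos (pos_iff_ne_zero.2 hS0) hStop).ne'
    exact (ENNReal.mul_le_mul_iff_left hne (ENNReal.rpow_ne_top_of_nonneg (by linarith) hStop)).1 h1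
  have := ENNReal.rpow_le_rpow h2 hr0.le
  rwa [← ENNReal.rpow_mul, one_div_mul_cancel hr0.ne', ENNReal.rpow_one] at this

/-! ### The gradient norm and the space `D^{1,p}` -/

theorem gradNorm_eq {d : ℕ} (p : ℝ) (u : Lattice d → ℝ) :
    gradNorm p u = (edgeEnergy (latticeGraph d) p u / 2) ^ (1 / p) := by
  let e : (Σ x : Lattice d, (latticeGraph d).neighborSet x) ≃ (latticeGraph d).Dart :=
    { toFun := fun a => ⟨(a.1, a.2), a.2.2⟩
      invFun := fun a => ⟨a.fst, a.snd, a.adj⟩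
      left_inv := fun _ => rfl
      right_inv := fun _ => rfl }
  rw [gradNorm, edgeEnergy, ← e.tsum_eq, ENNReal.tsum_sigma']
  rfl

theorem lNorm_eq {d : ℕ} (q : ℝ) (u : Lattice d → ℝ) : lNorm q u = powerSum q u ^ (1 / q) := rfl

theorem powerSum_eq_one_iff {d : ℕ} {q : ℝ} (hq : 0 < q) {u : Lattice d → ℝ} :
    powerSum q u = 1 ↔ lNorm q u = 1 := by
  rw [lNorm_eq]
  refine ⟨fun h => by rw [h, ENNReal.one_rpow], fun h => ?_⟩
  have := congrArg (· ^ q) h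
  simpa [← ENNReal.rpow_mul, hq.ne'] using this

theorem gradNorm_add_le {d : ℕ} {p : ℝ} (hp : 1 ≤ p) (u v : Lattice d → ℝ) :
    gradNorm p (u + v) ≤ gradNorm p u + gradNorm p v := by
  have hp0 : 0 < p := by linarith
  let _ : MeasurableSpace (latticeGraph d).Dart := ⊤
  have h := ENNReal.lintegral_Lp_add_le
    (μ := (MeasureTheory.Measure.count : MeasureTheory.Measure (latticeGraph d).Dart))
    (f := fun a => ‖u a.fst - u a.snd‖ₑ) (g := fun a => ‖v a.fst - v a.snd‖ₑ)
    Measurable.of_discrete.aemeasurable Measurable.of_discrete.aemeasurable hp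
  simp only [MeasureTheory.lintegral_count] at h
  simp only [gradNorm_eq, ENNReal.div_rpow_of_nonneg _ _ (one_div_nonneg.2 hp0.le)]
  rw [← ENNReal.add_div]
  refine ENNReal.div_le_div_right (le_trans ?_ h) _
  refine ENNReal.rpow_le_rpow (ENNReal.tsum_le_tsum fun a => ?_) (by positivity)
  refine ENNReal.rpow_le_rpow ?_ hp0.le
  have : (u + v) a.fst - (u + v) a.snd = (u a.fst - u a.snd) + (v a.fst - v a.snd) := by
    simp only [Pi.add_apply]
    ring
  rw [this]
  exact enorm_add_le _ _

theorem gradNorm_sub_comm {d : ℕ} (p : ℝ) (u v : Lattice d → ℝ) :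
    gradNorm p (u - v) = gradNorm p (v - u) := by
  rw [gradNorm_eq, gradNorm_eq]
  congr 2
  refine tsum_congr fun a => ?_
  rw [← enorm_neg]
  congr 2
  simp only [Pi.sub_apply]
  ring

theorem edgeEnergy_const_mul {V : Type*} (G : SimpleGraph V) {p : ℝ} (hp : 0 ≤ p) (c : ℝ)
    (u : V → ℝ) : edgeEnergy G p (fun x => c * u x) = ‖c‖ₑ ^ p * edgeEnergy G p u := by
  simp only [edgeEnergy, ← mul_sub, enorm_mul, ENNReal.mul_rpow_of_nonneg _ _ hp,
    ENNReal.tsum_mul_left]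

theorem powerSum_const_mul {V : Type*} {q : ℝ} (hq : 0 ≤ q) (c : ℝ)
    (u : V → ℝ) : powerSum q (fun x => c * u x) = ‖c‖ₑ ^ q * powerSum q u := by
  simp only [powerSum, enorm_mul, ENNReal.mul_rpow_of_nonneg _ _ hq, ENNReal.tsum_mul_left]

theorem edgeEnergy_abs_le {V : Type*} (G : SimpleGraph V) {p : ℝ} (hp : 0 ≤ p)
    (u : V → ℝ) : edgeEnergy G p (fun x => |u x|) ≤ edgeEnergy G p u := by
  refine ENNReal.tsum_le_tsum fun a => ENNReal.rpow_le_rpow ?_ hp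
  rw [Real.enorm_eq_ofReal_abs, Real.enorm_eq_ofReal_abs]
  exact ENNReal.ofReal_le_ofReal (abs_abs_sub_abs_le _ _)

theorem edgeEnergy_ne_top {d : ℕ} {p : ℝ} (hp : 0 < p) {u : Lattice d → ℝ}
    (hu : (Function.support u).Finite) : edgeEnergy (latticeGraph d) p u ≠ ∞ := by
  let f : Lattice d × Fin d × Bool → (latticeGraph d).Dart := fun z =>
    if z.2.2 then ⟨(z.1, z.1 + Pi.single z.2.1 1), ⟨z.2.1, .inr (by simp)⟩⟩
    else ⟨(z.1, z.1 - Pi.single z.2.1 1), ⟨z.2.1, .inl (by simp)⟩⟩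
  have hf : ∀ a : (latticeGraph d).Dart, a.fst ∈ Function.support u →
      a ∈ f '' (Function.support u ×ˢ Set.univ) := by
    rintro a ha
    obtain ⟨k, h | h⟩ := a.adj
    · refine ⟨(a.fst, k, false), ⟨ha, Set.mem_univ _⟩, ?_⟩
      ext1
      simp only [f, Bool.false_eq_true, if_false]
      exact Prod.ext rfl (by simp [h])
    · refine ⟨(a.fst, k, true), ⟨ha, Set.mem_univ _⟩, ?_⟩
      ext1
      simp only [f, if_true]
      exact Prod.ext rfl (by simp [h])
  have hfin : (f '' (Function.support u ×ˢ Set.univ)).Finite := (hu.prod Set.finite_univ).image f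
  have hfin2 := hfin.union (hfin.image SimpleGraph.Dart.symm)
  rw [edgeEnergy, tsum_eq_sum (s := hfin2.toFinset)]
  · exact (ENNReal.sum_lt_top.2 fun x _ => ENNReal.rpow_lt_top_of_nonneg hp.le enorm_ne_top).ne
  · intro a ha
    rw [Set.Finite.mem_toFinset] at ha
    have h1 : u a.fst = 0 := by
      by_contra h
      exact ha (.inl (hf a h))
    have h2 : u a.snd = 0 := by
      by_contra h
      exact ha (.inr ⟨a.symm, hf a.symm h, a.symm_symm⟩)
    simp [h1, h2, hp]

/-- Fatou's lemma for series. -/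
theorem tsum_le_of_tendsto {α : Type*} {f : ℕ → α → ℝ≥0∞} {g : α → ℝ≥0∞} {c : ℕ → ℝ≥0∞}
    {b : ℝ≥0∞} (hf : ∀ x, Tendsto (fun n => f n x) atTop (𝓝 (g x)))
    (hc : Tendsto c atTop (𝓝 b)) (h : ∀ n, ∑' x, f n x ≤ c n) : ∑' x, g x ≤ b := by
  rw [ENNReal.tsum_eq_iSup_sum]
  refine iSup_le fun s => ?_
  exact le_of_tendsto_of_tendsto' (tendsto_finsetSum s fun x _ => hf x) hc
    fun n => (ENNReal.sum_le_tsum s).trans (h n)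

theorem tendsto_enorm_rpow {p : ℝ} {f : ℕ → ℝ} {a : ℝ} (h : Tendsto f atTop (𝓝 a)) :
    Tendsto (fun n => ‖f n‖ₑ ^ p) atTop (𝓝 (‖a‖ₑ ^ p)) :=
  (ENNReal.continuous_rpow_const.tendsto _).comp ((continuous_enorm.tendsto a).comp h)

/-- A nonnegative function which vanishes at infinity and has finite energy is approximated by its
truncations `(u - ε)₊`: the difference is `min u ε`, whose energy tends to `0` by dominated
convergence. -/
theorem memD_of_admissible {d : ℕ} {p : ℝ} (hp : 0 < p) {u : Lattice d → ℝ} (hu : Admissible u)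
    (hE : edgeEnergy (latticeGraph d) p u ≠ ∞) : MemD p u := by
  let ε : ℕ → ℝ := fun n => 1 / ((n : ℝ) + 1)
  have hε : ∀ n, 0 < ε n := fun n => by positivity
  have hε0 : Tendsto ε atTop (𝓝 0) := tendsto_one_div_add_atTop_nhds_zero_nat
  have hmin : ∀ x, Tendsto (fun n => min (u x) (ε n)) atTop (𝓝 0) := fun x => by
    have := (tendsto_const_nhds (x := u x)).min hε0
    rwa [min_eq_right (hu.1 x)] at this
  refine ⟨fun n x => u x - min (u x) (ε n), fun n => ?_, ?_, fun x => ?_⟩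
  · refine (hu.2 (ε n) (hε n)).subset fun x hx => ?_
    by_contra h
    simp only [Set.mem_ofPred_eq, not_lt] at h
    refine hx ?_
    simp only
    rw [min_eq_left ((le_abs_self _).trans h), sub_self]
  · let _ : MeasurableSpace (latticeGraph d).Dart := ⊤
    have hlim := MeasureTheory.tendsto_lintegral_of_dominated_convergence
      (μ := (MeasureTheory.Measure.count : MeasureTheory.Measure (latticeGraph d).Dart))
      (F := fun n a => ‖min (u a.fst) (ε n) - min (u a.snd) (ε n)‖ₑ ^ p) (f := fun _ => 0)
      (fun a => ‖u a.fst - u a.snd‖ₑ ^ p) (fun n => Measurable.of_discrete)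
      (fun n => Eventually.of_forall fun a => ?_)
      (by simpa only [MeasureTheory.lintegral_count, edgeEnergy] using hE)
      (Eventually.of_forall fun a => ?_)
    · simp only [MeasureTheory.lintegral_count, tsum_zero] at hlim
      have h2 : Tendsto (fun t : ℝ≥0∞ => (t / 2) ^ (1 / p)) (𝓝 0) (𝓝 0) := by
        have hc : Continuous fun t : ℝ≥0∞ => (t / 2) ^ (1 / p) :=
          ENNReal.continuous_rpow_const.comp (ENNReal.continuous_div_const 2 two_ne_zero)
        simpa [hp] using hc.tendsto 0
      refine (h2.comp hlim).congr fun n => ?_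
      rw [gradNorm_eq]
      simp only [Function.comp_apply, edgeEnergy, Pi.sub_apply, sub_sub_cancel]
    · refine ENNReal.rpow_le_rpow ?_ hp.le
      rw [Real.enorm_eq_ofReal_abs, Real.enorm_eq_ofReal_abs]
      exact ENNReal.ofReal_le_ofReal (abs_inf_sub_inf_le_abs _ _ _)
    · have := tendsto_enorm_rpow (p := p) ((hmin a.fst).sub (hmin a.snd))
      simpa [hp] using this
  · simpa using (tendsto_const_nhds (x := u x)).sub (hmin x)

/-! ### The infimum over finitely supported functions -/

/-- The competitors in the minimization problem which are nonnegative and finitely supported. -/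
def finiteCompetitors (d : ℕ) (q : ℝ) : Set (Lattice d → ℝ) :=
  {u | (∀ x, 0 ≤ u x) ∧ (Function.support u).Finite ∧ powerSum q u = 1}

/-- The infimum of the energy over nonnegative finitely supported competitors. -/
noncomputable def finiteInf (d : ℕ) (p q : ℝ) : ℝ≥0∞ :=
  sInf (edgeEnergy (latticeGraph d) p '' finiteCompetitors d q)

theorem finiteCompetitors_nonempty (d : ℕ) {q : ℝ} (hq : 0 < q) :
    (finiteCompetitors d q).Nonempty := by
  classical
  refine ⟨Pi.single 0 1, fun x => ?_, (Set.finite_singleton 0).subset Pi.support_single_subset, ?_⟩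
  · rw [Pi.single_apply]
    split_ifs <;> norm_num
  · rw [powerSum, tsum_eq_single 0]
    · simp
    · intro x hx
      simp [hx, hq]

theorem finiteInf_ne_top (d : ℕ) {p q : ℝ} (hp : 0 < p) (hq : 0 < q) : finiteInf d p q ≠ ∞ := by
  obtain ⟨u, hu⟩ := finiteCompetitors_nonempty d hq
  exact ne_top_of_le_ne_top (edgeEnergy_ne_top hp hu.2.1) (sInf_le ⟨u, hu, rfl⟩)

/-- The infimum bounds the gradient norm of every finitely supported function, by homogeneity and
passing to `|u|`. -/
theorem finiteInf_mul_lNorm_le {d : ℕ} {p q : ℝ} (hp : 0 < p) (hq : 0 < q) {u : Lattice d → ℝ}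
    (hu : (Function.support u).Finite) :
    (finiteInf d p q / 2) ^ (1 / p) * lNorm q u ≤ gradNorm p u := by
  have htop : lNorm q u ≠ ∞ :=
    ENNReal.rpow_ne_top_of_nonneg (by positivity) (powerSum_ne_top hq hu)
  rcases eq_or_ne (lNorm q u) 0 with h0 | h0
  · rw [h0, mul_zero]; exact zero_le
  set c := (lNorm q u).toReal with hc
  have hc0 : 0 < c := ENNReal.toReal_pos h0 htop
  have hcn : ‖c‖ₑ = lNorm q u := by
    rw [Real.enorm_of_nonneg hc0.le, hc, ENNReal.ofReal_toReal htop]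
  have hcc : ‖c⁻¹‖ₑ * ‖c‖ₑ = 1 := by rw [← enorm_mul, inv_mul_cancel₀ hc0.ne']; simp
  have hS : powerSum q u = ‖c‖ₑ ^ q := by
    rw [hcn, lNorm_eq, ← ENNReal.rpow_mul, one_div_mul_cancel hq.ne', ENNReal.rpow_one]
  have habs : powerSum q (fun x => |u x|) = powerSum q u := by
    simp only [powerSum, Real.enorm_eq_ofReal_abs, abs_abs]
  have hmem : (fun x => c⁻¹ * |u x|) ∈ finiteCompetitors d q := by
    refine ⟨fun x => by positivity, hu.subset fun x hx h => hx (by simp [h]), ?_⟩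
    rw [powerSum_const_mul hq.le, habs, hS, ← ENNReal.mul_rpow_of_nonneg _ _ hq.le, hcc,
      ENNReal.one_rpow]
  have h1 : finiteInf d p q ≤ ‖c⁻¹‖ₑ ^ p * edgeEnergy (latticeGraph d) p u := by
    refine (sInf_le (Set.mem_image_of_mem _ hmem)).trans ?_
    rw [edgeEnergy_const_mul _ hp.le]
    gcongr
    exact edgeEnergy_abs_le _ hp.le u
  have h2 : (finiteInf d p q / 2) ^ (1 / p) ≤ ‖c⁻¹‖ₑ * gradNorm p u := by
    calc (finiteInf d p q / 2) ^ (1 / p)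
        ≤ (‖c⁻¹‖ₑ ^ p * edgeEnergy (latticeGraph d) p u / 2) ^ (1 / p) := by gcongr
      _ = ‖c⁻¹‖ₑ * gradNorm p u := by
        rw [mul_div_assoc, ENNReal.mul_rpow_of_nonneg _ _ (by positivity), ← ENNReal.rpow_mul,
          mul_one_div_cancel hp.ne', ENNReal.rpow_one, gradNorm_eq]
  calc (finiteInf d p q / 2) ^ (1 / p) * lNorm q u
      ≤ ‖c⁻¹‖ₑ * gradNorm p u * ‖c‖ₑ := by rw [hcn]; gcongr
    _ = gradNorm p u := by rw [mul_right_comm, hcc, one_mul]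

/-- Finitely supported competitors are as good as all competitors, by Fatou's lemma for the
`ℓ^q` norm and the triangle inequality for the gradient norm. -/
theorem finiteInf_le_gradNorm {d : ℕ} {p q : ℝ} (hp : 1 ≤ p) (hq : 0 < q) {u : Lattice d → ℝ}
    (hu : u ∈ sobolevConstraint d p q) : (finiteInf d p q / 2) ^ (1 / p) ≤ gradNorm p u := by
  have hp0 : 0 < p := by linarith
  obtain ⟨⟨φ, hφ, hgrad, hlim⟩, hnorm⟩ := hu
  set I := (finiteInf d p q / 2) ^ (1 / p) with hI
  have hItop : I ≠ ∞ := ENNReal.rpow_ne_top_of_nonneg (by positivity)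
    (ENNReal.div_ne_top (finiteInf_ne_top d hp0 hq) two_ne_zero)
  have hbound : ∀ n, I * lNorm q (φ n) ≤ gradNorm p u + gradNorm p (u - φ n) := fun n => by
    refine (finiteInf_mul_lNorm_le hp0 hq (hφ n)).trans ?_
    rw [gradNorm_sub_comm]
    calc gradNorm p (φ n) = gradNorm p (u + (φ n - u)) := by rw [add_sub_cancel]
      _ ≤ _ := gradNorm_add_le hp _ _
  have hfin : ∀ n, ∑' x, I ^ q * ‖φ n x‖ₑ ^ q ≤ (gradNorm p u + gradNorm p (u - φ n)) ^ q :=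
    fun n => by
      rw [ENNReal.tsum_mul_left]
      have := ENNReal.rpow_le_rpow (hbound n) hq.le
      rwa [ENNReal.mul_rpow_of_nonneg _ _ hq.le, lNorm_eq, ← ENNReal.rpow_mul (powerSum q (φ n)),
        one_div_mul_cancel hq.ne', ENNReal.rpow_one] at this
  have hc : Tendsto (fun n => (gradNorm p u + gradNorm p (u - φ n)) ^ q) atTop
      (𝓝 (gradNorm p u ^ q)) := by
    have := (tendsto_const_nhds (x := gradNorm p u)).add hgrad
    rw [add_zero] at this
    exact (ENNReal.continuous_rpow_const.tendsto _).comp this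
  have := tsum_le_of_tendsto (fun x => ENNReal.Tendsto.const_mul (tendsto_enorm_rpow (hlim x))
    (.inr (ENNReal.rpow_ne_top_of_nonneg hq.le hItop))) hc hfin
  have hS : ∑' x, ‖u x‖ₑ ^ q = 1 := (powerSum_eq_one_iff hq).2 hnorm
  rw [ENNReal.tsum_mul_left, hS, mul_one] at this
  exact (ENNReal.rpow_le_rpow_iff hq).1 this

/-! ### Compactness of folded minimizing sequences -/

/-- The uniform decay of folded functions bounds the mass outside a box. -/
theorem Folded.powerSum_le_box {d : ℕ} {u : Lattice d → ℝ} (hu : Folded u) (h0 : ∀ x, 0 ≤ u x)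
    {r q : ℝ} (hr : 0 < r) (hrq : r < q) {K : ℝ≥0∞} (hK : powerSum r u ≤ K) {m : ℕ}
    (hm : m ≠ 0) :
    powerSum q u ≤ ∑ x ∈ Finset.Icc (fun _ => -(m : ℤ)) (fun _ => (m : ℤ)), ‖u x‖ₑ ^ q +
      (K / m) ^ ((q - r) / r) * K := by
  classical
  set B : Finset (Lattice d) := Finset.Icc (fun _ => -(m : ℤ)) (fun _ => (m : ℤ)) with hB
  have hle : ∀ x, ‖u x‖ₑ ^ q ≤
      (if x ∈ B then ‖u x‖ₑ ^ q else 0) + (K / m) ^ ((q - r) / r) * ‖u x‖ₑ ^ r := fun x => by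
    split_ifs with hx
    · exact le_self_add
    · rw [zero_add]
      obtain ⟨i, hi⟩ : ∃ i, m ≤ (x i).natAbs := by
        by_contra! hlt
        refine hx (Finset.mem_Icc.2 ⟨fun i => ?_, fun i => ?_⟩) <;> have := hlt i <;> simp only <;>
          omega
      have h1 : ‖u x‖ₑ ^ r ≤ K / m := by
        refine ENNReal.le_div_iff_mul_le (.inl (Nat.cast_ne_zero.2 hm))
          (.inl (ENNReal.natCast_ne_top m)) |>.2 ?_
        rw [mul_comm]
        refine le_trans ?_ ((hu.natAbs_mul_le_powerSum h0 hr.le x i).trans hK)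
        gcongr
      calc ‖u x‖ₑ ^ q = (‖u x‖ₑ ^ r) ^ ((q - r) / r) * ‖u x‖ₑ ^ r := by
            rw [← ENNReal.rpow_mul, mul_div_cancel₀ _ hr.ne', ← ENNReal.rpow_add_of_nonneg _ _
              (by linarith) hr.le, sub_add_cancel]
        _ ≤ _ := by gcongr
  refine (ENNReal.tsum_le_tsum hle).trans ?_
  rw [ENNReal.tsum_add, ENNReal.tsum_mul_left, tsum_eq_sum (s := B) fun x hx => if_neg hx]
  rw [Finset.sum_congr rfl fun x hx => if_pos hx]
  gcongr
  exact hK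

/-- A sequence of folded functions with `‖u_n‖_q = 1`, bounded in `ℓ^r` for some `r < q`, has a
pointwise convergent subsequence, and no mass is lost in the limit. -/
theorem exists_subseq_tendsto {d : ℕ} {u : ℕ → Lattice d → ℝ} (hu : ∀ n, Folded (u n))
    (h0 : ∀ n x, 0 ≤ u n x) {r q : ℝ} (hr : 0 < r) (hrq : r < q) {K : ℝ≥0∞} (hKtop : K ≠ ∞)
    (hK : ∀ n, powerSum r (u n) ≤ K) (h1 : ∀ n, powerSum q (u n) = 1) :
    ∃ (v : Lattice d → ℝ) (φ : ℕ → ℕ), StrictMono φ ∧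
      (∀ x, Tendsto (fun n => u (φ n) x) atTop (𝓝 (v x))) ∧ (∀ x, 0 ≤ v x) ∧ Folded v ∧
      powerSum r v ≤ K ∧ powerSum q v = 1 := by
  have hq : 0 < q := hr.trans hrq
  have hmem : ∀ n, u n ∈ Set.pi Set.univ fun _ : Lattice d => Set.Icc (0 : ℝ) 1 := fun n x _ => by
    refine ⟨h0 n x, ?_⟩
    have : ‖u n x‖ₑ ^ q ≤ 1 := (ENNReal.le_tsum x).trans_eq (h1 n)
    have h2 := (ENNReal.rpow_le_rpow_iff hq).1 (this.trans_eq (ENNReal.one_rpow q).symm)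
    rw [Real.enorm_of_nonneg (h0 n x)] at h2
    exact ENNReal.ofReal_le_one.1 h2
  obtain ⟨v, -, φ, hφ, hv⟩ :=
    (isCompact_univ_pi fun _ : Lattice d => isCompact_Icc (a := (0 : ℝ)) (b := 1)).tendsto_subseq
      hmem
  rw [tendsto_pi_nhds] at hv
  have hfatou : ∀ s : ℝ, ∀ b, (∀ n, powerSum s (u n) ≤ b) → powerSum s v ≤ b := fun s b hb =>
    tsum_le_of_tendsto (fun x => tendsto_enorm_rpow (hv x)) tendsto_const_nhds
      fun n => hb (φ n)
  refine ⟨v, φ, hφ, hv, fun x => ge_of_tendsto' (hv x) fun n => h0 (φ n) x, fun e b x hx =>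
    le_of_tendsto_of_tendsto' (hv _) (hv x) fun n => hu (φ n) e b x hx, hfatou r K hK,
    le_antisymm (hfatou q 1 fun n => (h1 n).le) ?_⟩
  have hbox : ∀ m : ℕ, m ≠ 0 → 1 ≤ powerSum q v + (K / m) ^ ((q - r) / r) * K := fun m hm => by
    have hle : ∀ n, (1 : ℝ≥0∞) ≤ _ := fun n =>
      (h1 (φ n)).ge.trans ((hu (φ n)).powerSum_le_box (h0 (φ n)) hr hrq (hK (φ n)) hm)
    refine (ge_of_tendsto' ((tendsto_finsetSum _ fun x _ => tendsto_enorm_rpow (hv x)).add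
      tendsto_const_nhds) hle).trans ?_
    gcongr
    exact ENNReal.sum_le_tsum _
  have hsmall : Tendsto (fun m : ℕ => powerSum q v + (K / m) ^ ((q - r) / r) * K) atTop
      (𝓝 (powerSum q v + 0)) := by
    refine tendsto_const_nhds.add ?_
    have hs : 0 < (q - r) / r := div_pos (by linarith) hr
    have hdiv : Tendsto (fun m : ℕ => K / m) atTop (𝓝 0) := by
      have := ENNReal.Tendsto.const_div ENNReal.tendsto_nat_nhds_top (.inr hKtop)
      rwa [ENNReal.div_top] at this
    have hpow := (ENNReal.continuous_rpow_const (y := (q - r) / r)).tendsto 0 |>.comp hdiv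
    rw [ENNReal.zero_rpow_of_pos hs] at hpow
    simpa using ENNReal.Tendsto.mul_const hpow (.inr hKtop)
  rw [add_zero] at hsmall
  exact ge_of_tendsto hsmall ((eventually_ne_atTop 0).mono hbox)

theorem admissible_of_powerSum_ne_top {d : ℕ} {r : ℝ} (hr : 0 < r) {u : Lattice d → ℝ}
    (h0 : ∀ x, 0 ≤ u x) (h : powerSum r u ≠ ∞) : Admissible u := by
  refine ⟨h0, fun t ht => ?_⟩
  refine (ENNReal.finite_const_le_of_tsum_ne_top h (ε := ENNReal.ofReal t ^ r)
    (ENNReal.rpow_pos (ENNReal.ofReal_pos.2 ht) ENNReal.ofReal_ne_top).ne').subset fun x hx => ?_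
  have hx' : t ≤ |u x| := le_of_lt hx
  simp only [Set.mem_ofPred_eq, Real.enorm_eq_ofReal_abs]
  gcongr

end DiscreteSchwarz

open DiscreteSchwarz in
theorem mainTheorem12 (d : ℕ) (hd : 3 ≤ d) (p q : ℝ) (hp1 : 1 ≤ p) (hpd : p < (d : ℝ))
    (hq : (d : ℝ) * p / ((d : ℝ) - p) < q) :
    ∃ u : DiscreteSchwarz.Lattice d → ℝ,
      u ∈ DiscreteSchwarz.sobolevConstraint d p q ∧
      DiscreteSchwarz.gradNorm p u = DiscreteSchwarz.sobolevInf d p q ∧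
      DiscreteSchwarz.SchwarzSymmetric u := by
  have hp0 : 0 < p := by linarith
  have hr0 : 0 < d * p / (d - p) :=
    div_pos (mul_pos (hp0.trans hpd) hp0) (sub_pos.2 hpd)
  have hq0 : 0 < q := hr0.trans hq
  obtain ⟨e, he_anti, he_lim, he⟩ := exists_seq_tendsto_sInf
    ((finiteCompetitors_nonempty d hq0).image (edgeEnergy (latticeGraph d) p)) (OrderBot.bddBelow _)
  choose φ hφ hφe using he
  have hfold : ∀ n, ∃ v : Lattice d → ℝ, (∀ x, 0 ≤ v x) ∧ (Function.support v).Finite ∧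
      powerSum q v = 1 ∧ edgeEnergy (latticeGraph d) p v ≤ e n ∧ Folded v := fun n => by
    obtain ⟨v, h0, hv, hvq, hvp, hfold⟩ := exists_folded
      (fun i : Direction d × Bool => i.1.folding i.2) hp1 q (hφ n).1 (hφ n).2.1
    exact ⟨v, h0, hv, hvq.trans (hφ n).2.2, hvp.trans_eq (hφe n), fun i b => hfold (i, b)⟩
  choose v hv0 hvs hvq hve hvf using hfold
  have he0 : e 0 ≠ ∞ := hφe 0 ▸ edgeEnergy_ne_top hp0 (hφ 0).2.1
  let C : ℝ≥0∞ := d * (ENNReal.ofReal (p * (d - 1) / (d - p)) * 2)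
  have hCtop : C ≠ ∞ := ENNReal.mul_ne_top (ENNReal.natCast_ne_top d)
    (ENNReal.mul_ne_top ENNReal.ofReal_ne_top ENNReal.ofNat_ne_top)
  -- The energies `e n` decrease, so the Sobolev bound is uniform.
  have hK : ∀ n, powerSum (d * p / (d - p)) (v n) ≤ (C * e 0 ^ (1 / p)) ^ (d * p / (d - p)) :=
    fun n => by
      refine (sobolev_inequality (by omega) hp1 hpd (hv0 n) (hvs n)).trans ?_
      have := (hve n).trans (he_anti (Nat.zero_le n))
      gcongr
  have hKtop : (C * e 0 ^ (1 / p)) ^ (d * p / (d - p)) ≠ ∞ :=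
    ENNReal.rpow_ne_top_of_nonneg hr0.le (ENNReal.mul_ne_top hCtop
      (ENNReal.rpow_ne_top_of_nonneg (by positivity) he0))
  obtain ⟨u, ψ, hψ, hlim, hu0, huf, hur, huq⟩ :=
    exists_subseq_tendsto hvf hv0 hr0 hq hKtop hK hvq
  have hE : edgeEnergy (latticeGraph d) p u ≤ finiteInf d p q :=
    tsum_le_of_tendsto (fun a => tendsto_enorm_rpow ((hlim a.fst).sub (hlim a.snd)))
      (he_lim.comp hψ.tendsto_atTop) fun n => hve (ψ n)
  have hadm := admissible_of_powerSum_ne_top hr0 hu0 (ne_top_of_le_ne_top hKtop hur)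
  have hmem : u ∈ sobolevConstraint d p q :=
    ⟨memD_of_admissible hp0 hadm (ne_top_of_le_ne_top (finiteInf_ne_top d hp0 hq0) hE),
      (powerSum_eq_one_iff hq0).1 huq⟩
  refine ⟨u, hmem, le_antisymm ?_ (iInf₂_le u hmem), schwarzSymmetric_of_folded hadm huf⟩
  refine le_iInf₂ fun w hw => le_trans ?_ (finiteInf_le_gradNorm hp1 hq0 hw)
  rw [gradNorm_eq]
  gcongr
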